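/- Let $N$ be a smooth ($C^\infty$, Hausdorff, second countable, boundaryless) $n$-dimensional manifold, let $s,n\ge 0$ be integers, and fix $t_0\in\mathbb{R}^s$. A *generalised $t$-flow on $N$ with foot point $t_0$* is a smooth family $g=\{g_t\}_{t\in\mathbb{R}^s}$ of diffeomorphisms of $N$ with $g_{t_0}=\mathrm{id}_N$, where smooth means that $(t,x)\mapsto(t,g_t(x))$ is a diffeomorphism of $\mathbb{R}^s\times N$. An *integrable $t$-dependent polyvector field* on $N$ is an $s$-tuple ${\bf X}=(X_1,\dots,X_s)$ of smooth $t$-dependent vector fields $X_\pi:\mathbb{R}^s\times N\to TN$, with $X_\pi(t,x)\in T_xN$, satisfying the zero curvature condition $$\left[\frac{\partial}{\partial t_\pi}+X_\pi,\ \frac{\partial}{\partial t_\nu}+X_\nu\right]=0\quad\text{on }\mathbb{R}^s\times N,\qquad \pi,\nu=1,\dots,s.$$ Two generalised $t$-flows with foot point $t_0$ (respectively, two integrable $t$-dependent polyvector fields) *have the same germ* if they coincide on some open neighbourhood of $\{t_0\}\times N$ in $\mathbb{R}^s\times N$. **Theorem.** For every generalised $t$-flow $g$ with foot point $t_0$,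 the formula $$(X_\pi)_t=\frac{\partial g_t}{\partial t_\pi}\circ g_t^{-1},\qquad \pi=1,\dots,s,\quad t\in\mathbb{R}^s,$$ (both sides being maps $N\to TN$) defines an integrable $t$-dependent polyvector field ${\bf X}$ on $N$. The germ of ${\bf X}$ depends only on the germ of $g$, and the resulting map from germs of generalised $t$-flows with foot point $t_0$ to germs of integrable $t$-dependent polyvector fields on $N$ is a bijection. -/

import Mathlib

open scoped Manifold ContDiff Topology

noncomputable section

namespace TFlow

/-- The parameter space `ℝ^s` with coordinates `t = (t_1, …, t_s)`. -/
abbrev Time (s : ℕ) : Type := EuclideanSpace ℝ (Fin s)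

/-- The coordinate vector `∂/∂t_π` of `ℝ^s`. -/
abbrev dirT {s : ℕ} (π : Fin s) : Time s := EuclideanSpace.single π (1 : ℝ)

/-- A smooth `t`-dependent polyvector field `X : ℝ^s × N → TN ⊗ ℝ^s`, given by its components
`X = (X_1, …, X_s)`, which are smooth `t`-dependent vector fields on `N`. -/
structure PolyField (s n : ℕ) (N : Type*) [TopologicalSpace N]
    [ChartedSpace (EuclideanSpace ℝ (Fin n)) N] [IsManifold (𝓡 n) ∞ N] where
  /-- `vec π t x` is the tangent vector `X_π(t, x) ∈ T_x N`. -/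
  vec : Fin s → Time s → (x : N) → TangentSpace (𝓡 n) x
  smooth : ∀ π : Fin s, ContMDiff ((𝓡 s).prod (𝓡 n)) (𝓡 n).tangent ∞
    (fun p : Time s × N => (⟨p.2, vec π p.1 p.2⟩ : TangentBundle (𝓡 n) N))

/-- A generalised `t`-flow on `N` with foot point `t₀`: a smooth family `g_t`, `t ∈ ℝ^s`, of
diffeomorphisms of `N` with `g_{t₀} = id`. Smoothness of the family means that its autonomisation
`(t, x) ↦ (t, g_t x)` is a diffeomorphism of `ℝ^s × N`. -/
structure GenFlow (s n : ℕ) (N : Type*) [TopologicalSpace N]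
    [ChartedSpace (EuclideanSpace ℝ (Fin n)) N] [IsManifold (𝓡 n) ∞ N] (t₀ : Time s) where
  /-- The diffeomorphism `g_t`. -/
  diffeo : Time s → N ≃ₘ^∞⟮𝓡 n, 𝓡 n⟯ N
  smooth : ContMDiff ((𝓡 s).prod (𝓡 n)) (𝓡 n) ∞ (fun p : Time s × N => diffeo p.1 p.2)
  smooth_symm : ContMDiff ((𝓡 s).prod (𝓡 n)) (𝓡 n) ∞
    (fun p : Time s × N => (diffeo p.1).symm p.2)
  foot : diffeo t₀ = Diffeomorph.refl (𝓡 n) N ∞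

variable {s n : ℕ} {N : Type*} [TopologicalSpace N]
  [ChartedSpace (EuclideanSpace ℝ (Fin n)) N] [IsManifold (𝓡 n) ∞ N]

/-- `(X_π)_t`, as a map from `N` into `TN`. -/
def PolyField.toTangent (X : PolyField s n N) (π : Fin s) (t : Time s) :
    N → TangentBundle (𝓡 n) N :=
  fun x => ⟨x, X.vec π t x⟩

/-- The components `∂/∂t_π + X_π` of the autonomisation of `X`, vector fields on `ℝ^s × N`. -/
def PolyField.auton (X : PolyField s n N) (π : Fin s) (p : Time s × N) :
    TangentSpace ((𝓡 s).prod (𝓡 n)) p :=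
  ((dirT π, X.vec π p.1 p.2) : Time s × EuclideanSpace ℝ (Fin n))

/-- Integrability, i.e. the zero curvature condition `[∂_π + X_π, ∂_ν + X_ν] = 0`. -/
def PolyField.IsIntegrable (X : PolyField s n N) : Prop :=
  ∀ (π ν : Fin s) (p : Time s × N),
    VectorField.mlieBracket ((𝓡 s).prod (𝓡 n)) (X.auton π) (X.auton ν) p = 0

/-- `∂g_t/∂t_π`, as a map from `N` into `TN` (covering `g_t`). -/
def GenFlow.timeDeriv {t₀ : Time s} (g : GenFlow s n N t₀) (π : Fin s) (t : Time s) :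
    N → TangentBundle (𝓡 n) N :=
  fun x => ⟨g.diffeo t x,
    mfderiv (𝓡 s) (𝓡 n) (fun τ : Time s => g.diffeo τ x) t (dirT π : Time s)⟩

/-- `g` generates `X`: `(X_π)_t = ∂g_t/∂t_π ∘ g_t⁻¹` for all `π` and `t`. -/
def GenFlow.Generates {t₀ : Time s} (g : GenFlow s n N t₀) (X : PolyField s n N) : Prop :=
  ∀ (π : Fin s) (t : Time s), X.toTangent π t = g.timeDeriv π t ∘ (g.diffeo t).symm

/-- Two flows with foot point `t₀` have the same germ when they agree on a neighbourhood of
`{t₀} × N` in `ℝ^s × N`. -/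
def flowSetoid (s n : ℕ) (N : Type*) [TopologicalSpace N]
    [ChartedSpace (EuclideanSpace ℝ (Fin n)) N] [IsManifold (𝓡 n) ∞ N] (t₀ : Time s) :
    Setoid (GenFlow s n N t₀) where
  r g h := ∀ᶠ p : Time s × N in 𝓝ˢ (({t₀} : Set (Time s)) ×ˢ (Set.univ : Set N)),
    g.diffeo p.1 p.2 = h.diffeo p.1 p.2
  iseqv :=
    { refl := fun _ => Filter.Eventually.of_forall fun _ => rfl
      symm := fun h => h.mono fun _ hp => hp.symm
      trans := fun h k => (h.and k).mono fun _ hp => hp.1.trans hp.2 }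

/-- Germs of generalised `t`-flows with foot point `t₀`. -/
def FlowGerm (s n : ℕ) (N : Type*) [TopologicalSpace N]
    [ChartedSpace (EuclideanSpace ℝ (Fin n)) N] [IsManifold (𝓡 n) ∞ N] (t₀ : Time s) : Type _ :=
  Quotient (flowSetoid s n N t₀)

/-- Integrable `t`-dependent polyvector fields. -/
abbrev IntegrableField (s n : ℕ) (N : Type*) [TopologicalSpace N]
    [ChartedSpace (EuclideanSpace ℝ (Fin n)) N] [IsManifold (𝓡 n) ∞ N] : Type _ :=
  {X : PolyField s n N // X.IsIntegrable}

/-- Two integrable polyvector fields have the same germ at `t₀` when they agree on a neighbourhood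
of `{t₀} × N` in `ℝ^s × N`. -/
def fieldSetoid (s n : ℕ) (N : Type*) [TopologicalSpace N]
    [ChartedSpace (EuclideanSpace ℝ (Fin n)) N] [IsManifold (𝓡 n) ∞ N] (t₀ : Time s) :
    Setoid (IntegrableField s n N) where
  r X Y := ∀ᶠ p : Time s × N in 𝓝ˢ (({t₀} : Set (Time s)) ×ˢ (Set.univ : Set N)),
    ∀ π : Fin s, X.1.vec π p.1 p.2 = Y.1.vec π p.1 p.2
  iseqv :=
    { refl := fun _ => Filter.Eventually.of_forall fun _ _ => rfl
      symm := fun h => h.mono fun _ hp π => (hp π).symm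
      trans := fun h k => (h.and k).mono fun _ hp π => (hp.1 π).trans (hp.2 π) }

/-- Germs at `t₀` of integrable `t`-dependent polyvector fields. -/
def FieldGerm (s n : ℕ) (N : Type*) [TopologicalSpace N]
    [ChartedSpace (EuclideanSpace ℝ (Fin n)) N] [IsManifold (𝓡 n) ∞ N] (t₀ : Time s) : Type _ :=
  Quotient (fieldSetoid s n N t₀)

/-- The germ of a generalised `t`-flow. -/
def GenFlow.germ {t₀ : Time s} (g : GenFlow s n N t₀) : FlowGerm s n N t₀ :=
  Quotient.mk (flowSetoid s n N t₀) g

/-- The germ at `t₀` of an integrable `t`-dependent polyvector field. -/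
def fieldGerm (t₀ : Time s) (X : PolyField s n N) (hX : X.IsIntegrable) : FieldGerm s n N t₀ :=
  Quotient.mk (fieldSetoid s n N t₀) ⟨X, hX⟩

end TFlow

end

open scoped Manifold ContDiff Topology
open Set VectorField

noncomputable section

namespace TFlow

section Omega

universe u

/-- Pointwise application of a continuous family of operators, as a continuous bilinear map. -/
noncomputable def pointwiseApply (K : Type*) [TopologicalSpace K] [CompactSpace K]
    (E F : Type*) [NormedAddCommGroup E] [NormedSpace ℝ E]
    [NormedAddCommGroup F] [NormedSpace ℝ F] :
    C(K, E →L[ℝ] F) →L[ℝ] C(K, E) →L[ℝ] C(K, F) :=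
  LinearMap.mkContinuous₂
    (LinearMap.mk₂ ℝ
      (fun (A : C(K, E →L[ℝ] F)) (α : C(K, E)) => (⟨fun k => A k (α k), by fun_prop⟩ : C(K, F)))
      (fun A B α => by ext; simp) (fun c A α => by ext; simp)
      (fun A α β => by ext; simp) (fun c A α => by ext; simp)) 1
    (fun A α => by
      rw [one_mul]
      refine (ContinuousMap.norm_le _ (by positivity)).mpr fun k => ?_
      exact (ContinuousLinearMap.le_opNorm _ _).trans
        (mul_le_mul (A.norm_coe_le_norm k) (α.norm_coe_le_norm k) (norm_nonneg (α k))
          (norm_nonneg A)))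

variable {K : Type*} [TopologicalSpace K] [CompactSpace K]

lemma hasFDerivAt_postcomp {E F : Type*} [NormedAddCommGroup E] [NormedSpace ℝ E]
    [NormedAddCommGroup F] [NormedSpace ℝ F] (f : C(E, F)) (f' : C(E, E →L[ℝ] F))
    (hf : ∀ x, HasFDerivAt f (f' x) x) (α : C(K, E)) :
    HasFDerivAt (fun β : C(K, E) => f.comp β) (pointwiseApply K E F (f'.comp α)) α := by
  rw [hasFDerivAt_iff_isLittleO_nhds_zero, Asymptotics.isLittleO_iff]
  intro c hc
  have hcont : ContinuousAt (fun β : C(K, E) => f'.comp β) α :=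
    (ContinuousMap.continuous_postcomp f').continuousAt
  obtain ⟨δ, hδ, h⟩ := (Metric.continuousAt_iff (α := C(K, E)) (β := C(K, E →L[ℝ] F))).mp hcont c hc
  filter_upwards [Metric.ball_mem_nhds (0 : C(K, E)) hδ] with v hv
  rw [ContinuousMap.norm_le _ (by positivity)]
  intro k
  have hseg : ∀ y ∈ segment ℝ (α k) (α k + v k), ‖f' y - f' (α k)‖ ≤ c := by
    rintro y hy
    rw [segment_eq_image'] at hy
    obtain ⟨r, hr, rfl⟩ := hy
    have h1 : dist (α + r • v) α < δ := by
      rw [dist_eq_norm, add_sub_cancel_left, norm_smul, Real.norm_of_nonneg hr.1]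
      rw [mem_ball_zero_iff] at hv
      calc r * ‖v‖ ≤ 1 * ‖v‖ := by gcongr; exact hr.2
        _ < δ := by simpa using hv
    have h2 := (ContinuousMap.dist_apply_le_dist k).trans (h h1).le
    simpa [dist_eq_norm] using h2
  have h3 := (convex_segment (α k) (α k + v k)).norm_image_sub_le_of_norm_hasFDerivWithin_le'
    (f := f) (f' := f') (φ := f' (α k)) (fun x _ => (hf x).hasFDerivWithinAt) hseg
    (left_mem_segment ℝ _ _) (right_mem_segment ℝ _ _)
  rw [add_sub_cancel_left] at h3
  exact h3.trans (mul_le_mul_of_nonneg_left (v.norm_coe_le_norm k) hc.le)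

/-- Post-composition with a `C^m` map is a `C^m` operation on spaces of continuous maps. -/
lemma contDiff_postcomp (m : ℕ) {E F : Type u} [NormedAddCommGroup E] [NormedSpace ℝ E]
    [NormedAddCommGroup F] [NormedSpace ℝ F] (f : C(E, F)) (hf : ContDiff ℝ m f) :
    ContDiff ℝ m (fun β : C(K, E) => f.comp β) := by
  induction m generalizing F with
  | zero => exact contDiff_zero.mpr (ContinuousMap.continuous_postcomp f)
  | succ m ih =>
    rw [Nat.cast_add, Nat.cast_one, contDiff_succ_iff_hasFDerivAt] at hf ⊢
    obtain ⟨f', hf', hd⟩ := hf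
    refine ⟨fun β => pointwiseApply K E F ((⟨f', hf'.continuous⟩ : C(E, E →L[ℝ] F)).comp β),
      ContDiff.comp (g := pointwiseApply K E F)
        (by apply ContinuousLinearMap.contDiff)
        (ih ⟨f', hf'.continuous⟩ hf'), fun α => hasFDerivAt_postcomp f ⟨f', hf'.continuous⟩ hd α⟩

end Omega

section LocalFlow

/-- The interval on which solution curves are parametrised. -/
abbrev unitIcc : Type := Icc (-1 : ℝ) 1

lemma unitIcc_le : (-1 : ℝ) ≤ 1 := by norm_num

variable {E : Type} [NormedAddCommGroup E] [NormedSpace ℝ E]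

lemma norm_IccExtend_le {E : Type} [NormedAddCommGroup E] (α : C(unitIcc, E)) (t : ℝ) : ‖IccExtend unitIcc_le α t‖ ≤ ‖α‖ :=
  α.norm_coe_le_norm _

lemma continuous_IccExtend {E : Type} [TopologicalSpace E] (α : C(unitIcc, E)) : Continuous (IccExtend unitIcc_le α) :=
  α.continuous.Icc_extend'

lemma continuous_primitive_IccExtend (α : C(unitIcc, E)) :
    Continuous fun t : ℝ => ∫ r in (0 : ℝ)..t, IccExtend unitIcc_le α r :=
  intervalIntegral.continuous_primitive (fun _ _ => (continuous_IccExtend α).intervalIntegrable _ _) 0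

/-- The primitive vanishing at `0`, as an operator on continuous curves. -/
noncomputable def primitive (E : Type) [NormedAddCommGroup E] [NormedSpace ℝ E] :
    C(unitIcc, E) →L[ℝ] C(unitIcc, E) :=
  LinearMap.mkContinuous
    { toFun := fun α => ⟨fun t => ∫ r in (0 : ℝ)..t, IccExtend unitIcc_le α r,
        (continuous_primitive_IccExtend α).comp continuous_subtype_val⟩
      map_add' := fun α β => by
        ext t
        exact intervalIntegral.integral_add ((continuous_IccExtend α).intervalIntegrable _ _)
          ((continuous_IccExtend β).intervalIntegrable _ _)
      map_smul' := fun c α => by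
        ext t
        exact intervalIntegral.integral_smul c _ } 1
    (fun α => by
      rw [one_mul, ContinuousMap.norm_le _ (norm_nonneg _)]
      intro t
      have h := intervalIntegral.norm_integral_le_of_norm_le_const (a := 0) (b := (t : ℝ))
        (f := IccExtend unitIcc_le α) (C := ‖α‖) (fun r _ => norm_IccExtend_le α r)
      have ht : |(t : ℝ) - 0| ≤ 1 := by rw [sub_zero]; exact abs_le.mpr t.2
      exact h.trans (mul_le_of_le_one_right (norm_nonneg _) ht))

lemma primitive_apply (α : C(unitIcc, E)) (t : unitIcc) :
    primitive E α t = ∫ r in (0 : ℝ)..t, IccExtend unitIcc_le α r := rfl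

/-- Constant curves, as an operator. -/
noncomputable def constCurve (E : Type) [NormedAddCommGroup E] [NormedSpace ℝ E] :
    E →L[ℝ] C(unitIcc, E) :=
  LinearMap.mkContinuous
    { toFun := fun x => ContinuousMap.const unitIcc x
      map_add' := fun x y => rfl
      map_smul' := fun c x => rfl } 1
    (fun x => by
      rw [one_mul]
      exact (ContinuousMap.norm_le _ (norm_nonneg _)).mpr fun _ => le_rfl)

lemma constCurve_apply (x : E) (t : unitIcc) : constCurve E x t = x := rfl

lemma hasDerivAt_of_eq_primitive [CompleteSpace E] (f : E → E) (hf : Continuous f) (r : ℝ) (x : E)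
    (α : C(unitIcc, E))
    (h : α = constCurve E x + r • primitive E ((⟨f, hf⟩ : C(E, E)).comp α)) {t : ℝ}
    (ht : t ∈ Ioo (-1 : ℝ) 1) :
    HasDerivAt (IccExtend unitIcc_le α) (r • f (IccExtend unitIcc_le α t)) t := by
  set β : C(unitIcc, E) := (⟨f, hf⟩ : C(E, E)).comp α with hβ
  have h1 : HasDerivAt (fun t : ℝ => x + r • ∫ u in (0 : ℝ)..t, IccExtend unitIcc_le β u)
      (r • IccExtend unitIcc_le β t) t :=
    ((intervalIntegral.integral_hasDerivAt_right
      ((continuous_IccExtend β).intervalIntegrable _ _)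
      ((continuous_IccExtend β).stronglyMeasurableAtFilter _ _)
      (continuous_IccExtend β).continuousAt).const_smul r).const_add x
  have h2 : IccExtend unitIcc_le α =ᶠ[𝓝 t]
      fun t : ℝ => x + r • ∫ u in (0 : ℝ)..t, IccExtend unitIcc_le β u := by
    filter_upwards [Ioo_mem_nhds ht.1 ht.2] with u hu
    rw [IccExtend_of_mem _ _ (Ioo_subset_Icc_self hu), h]
    rfl
  exact h1.congr_of_eventuallyEq h2


/-- Smooth dependence of solutions on time and initial value, for a globally defined smooth field:
`θ (r, x)` is the solution of `γ' = r • f γ`, `γ 0 = x`. -/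
lemma exists_smooth_local_solution_of_contDiff [CompleteSpace E] (f : E → E) (hf : ContDiff ℝ ∞ f) (x₀ : E) :
    ∃ θ : ℝ × E → ℝ → E, (∀ t, ContDiffAt ℝ ∞ (fun p => θ p t) (0, x₀)) ∧
      ∀ ε > 0, ∀ᶠ p in 𝓝 ((0 : ℝ), x₀), θ p 0 = p.2 ∧
        ∀ t ∈ Ioo (-1 : ℝ) 1, HasDerivAt (θ p) (p.1 • f (θ p t)) t ∧ dist (θ p t) x₀ < ε := by
  let fc : C(E, E) := ⟨f, hf.continuous⟩
  let G : (ℝ × E) × C(unitIcc, E) → C(unitIcc, E) := fun q =>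
    q.2 - constCurve E q.1.2 - q.1.1 • primitive E (fc.comp q.2)
  have hpost : ContDiff ℝ ∞ (fun β : C(unitIcc, E) => fc.comp β) :=
    contDiff_infty.mpr fun m => contDiff_postcomp m fc (hf.of_le (by exact_mod_cast le_top))
  have hprim : ContDiff ℝ ∞ (fun β : C(unitIcc, E) => primitive E (fc.comp β)) :=
    ContDiff.comp (g := primitive E) (primitive E).contDiff hpost
  have hsmul : ContDiff ℝ ∞ (fun q : (ℝ × E) × C(unitIcc, E) =>
      q.1.1 • primitive E (fc.comp q.2)) :=
    (contDiff_fst.comp contDiff_fst).smul (hprim.comp contDiff_snd)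
  have hG : ContDiff ℝ ∞ G :=
    (contDiff_snd.sub ((constCurve E).contDiff.comp (contDiff_snd.comp contDiff_fst))).sub hsmul
  let u : (ℝ × E) × C(unitIcc, E) := ((0, x₀), constCurve E x₀)
  have hGu : G u = 0 := by simp [G, u]
  have hid : fderiv ℝ G u ∘L .inr ℝ (ℝ × E) C(unitIcc, E) = .id ℝ _ := by
    have h1 : HasFDerivAt (fun α : C(unitIcc, E) => G ((0, x₀), α))
        (fderiv ℝ G u ∘L .inr ℝ (ℝ × E) C(unitIcc, E)) (constCurve E x₀) :=
      ((hG.differentiable (by simp) u).hasFDerivAt).comp (constCurve E x₀)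
        (hasFDerivAt_prodMk_right (0, x₀) (constCurve E x₀))
    have h2 : HasFDerivAt (fun α : C(unitIcc, E) => G ((0, x₀), α))
        (.id ℝ _) (constCurve E x₀) := by
      have : (fun α : C(unitIcc, E) => G ((0, x₀), α)) = fun α => α - constCurve E x₀ := by
        funext α; simp [G]
      rw [this]
      exact (hasFDerivAt_id _).sub_const _
    exact h1.unique h2
  have hinv : (fderiv ℝ G u ∘L .inr ℝ (ℝ × E) C(unitIcc, E)).IsInvertible := by
    rw [hid]; exact ⟨.refl ℝ _, rfl⟩
  have hcd : ContDiffAt ℝ ∞ G u := hG.contDiffAt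
  have hne : (∞ : ℕ∞ω) ≠ 0 := by simp
  set ψ : ℝ × E → C(unitIcc, E) := hcd.implicitFunction hne hinv with hψ
  have hψ0 : ψ (0, x₀) = constCurve E x₀ := hcd.implicitFunction_apply_self hne hinv
  have hψs : ContDiffAt ℝ ∞ ψ (0, x₀) := hcd.contDiffAt_implicitFunction hne hinv
  have hψe : ∀ᶠ p in 𝓝 ((0 : ℝ), x₀), G (p, ψ p) = 0 := by
    have := hcd.eventually_apply_implicitFunction hne hinv
    rwa [hGu] at this
  refine ⟨fun p => IccExtend unitIcc_le (ψ p), fun t => ?_, fun ε hε => ?_⟩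
  · exact ContDiffAt.comp (0, x₀)
      (g := ContinuousMap.evalCLM ℝ (projIcc (-1 : ℝ) 1 unitIcc_le t))
      (ContinuousLinearMap.contDiff _).contDiffAt hψs
  · have hball : ∀ᶠ p in 𝓝 ((0 : ℝ), x₀), dist (ψ p) (constCurve E x₀) < ε := by
      have := hψs.continuousAt (Metric.ball_mem_nhds (ψ (0, x₀)) hε)
      rw [hψ0] at this
      exact this
    filter_upwards [hψe, hball] with p hp hd
    have hp' : ψ p = constCurve E p.2 + p.1 • primitive E (fc.comp (ψ p)) := by
      have : ψ p - constCurve E p.2 - p.1 • primitive E (fc.comp (ψ p)) = 0 := hp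
      rwa [sub_sub, sub_eq_zero] at this
    refine ⟨?_, fun t ht => ⟨hasDerivAt_of_eq_primitive f hf.continuous p.1 p.2 (ψ p) hp' ht, ?_⟩⟩
    · have h0 : (0 : ℝ) ∈ Icc (-1 : ℝ) 1 := by norm_num
      change IccExtend unitIcc_le (ψ p) 0 = p.2
      rw [IccExtend_of_mem _ _ h0, hp', ContinuousMap.add_apply, ContinuousMap.smul_apply,
        primitive_apply, constCurve_apply]
      simp
    · exact (ContinuousMap.dist_apply_le_dist _).trans_lt hd

/-- Smooth dependence of solutions on time and initial value, for a field smooth on an open set. -/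
lemma exists_smooth_local_solution [FiniteDimensional ℝ E] (f : E → E) {U : Set E} (hU : IsOpen U)
    (hf : ContDiffOn ℝ ∞ f U) {x₀ : E} (hx₀ : x₀ ∈ U) :
    ∃ θ : ℝ × E → ℝ → E, (∀ t, ContDiffAt ℝ ∞ (fun p => θ p t) (0, x₀)) ∧
      ∀ᶠ p in 𝓝 ((0 : ℝ), x₀), θ p 0 = p.2 ∧
        ∀ t ∈ Ioo (-1 : ℝ) 1, HasDerivAt (θ p) (p.1 • f (θ p t)) t ∧ θ p t ∈ U := by
  have := FiniteDimensional.complete ℝ E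
  obtain ⟨ε, hε, hεU⟩ := Metric.isOpen_iff.mp hU x₀ hx₀
  let b : ContDiffBump x₀ := ⟨ε / 3, ε / 2, by positivity, by linarith⟩
  have hg : ContDiff ℝ ∞ (fun x => b x • f x) := by
    rw [contDiff_iff_contDiffAt]
    intro x
    by_cases hx : x ∈ U
    · exact b.contDiff.contDiffAt.smul (hf.contDiffAt (hU.mem_nhds hx))
    · have : (fun x => b x • f x) =ᶠ[𝓝 x] fun _ => 0 := by
        have hxs : x ∈ (Metric.closedBall x₀ (ε / 2))ᶜ := fun h =>
          hx (hεU (Metric.closedBall_subset_ball (by linarith) h))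
        filter_upwards [Metric.isClosed_closedBall.isOpen_compl.mem_nhds hxs] with y hy
        rw [b.zero_of_le_dist, zero_smul]
        simp only [mem_compl_iff, Metric.mem_closedBall, not_le] at hy
        exact hy.le
      exact contDiffAt_const.congr_of_eventuallyEq this
  obtain ⟨θ, hθ, h⟩ := exists_smooth_local_solution_of_contDiff _ hg x₀
  refine ⟨θ, hθ, (h (ε / 3) (by positivity)).mono fun p hp => ⟨hp.1, fun t ht => ?_⟩⟩
  obtain ⟨h1, h2⟩ := hp.2 t ht
  refine ⟨?_, hεU (Metric.mem_ball.mpr (h2.trans (by linarith)))⟩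
  rwa [b.one_of_mem_closedBall (Metric.mem_closedBall.mpr h2.le), one_smul] at h1

end LocalFlow

section FlowGroup

variable {E : Type*} [NormedAddCommGroup E] [NormedSpace ℝ E]
  {H : Type*} [TopologicalSpace H] {I : ModelWithCorners ℝ E H} [I.Boundaryless]
  {M : Type*} [TopologicalSpace M] [ChartedSpace H M] [IsManifold I 1 M] [T2Space M]
  {V : (x : M) → TangentSpace I x}

/-- The group law of the flow of a complete vector field. -/
lemma flow_add (hV : ContMDiff I I.tangent 1 (fun x => (⟨x, V x⟩ : TangentBundle I M)))
    {Θ : ℝ → M → M} (h0 : ∀ x, Θ 0 x = x)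
    (hΘ : ∀ x, IsMIntegralCurve (I := I) (fun r => Θ r x) V) (r r' : ℝ) (x : M) :
    Θ (r + r') x = Θ r (Θ r' x) := by
  have := isMIntegralCurve_Ioo_eq_of_contMDiff_boundaryless (t₀ := 0) hV
    ((hΘ x).comp_add r') (hΘ (Θ r' x)) (by simp [h0])
  exact congrFun this r

end FlowGroup

section ManifoldFlow

variable {E : Type} [NormedAddCommGroup E] [NormedSpace ℝ E]
  {H : Type*} [TopologicalSpace H] {I : ModelWithCorners ℝ E H}
  {M : Type*} [TopologicalSpace M] [ChartedSpace H M]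
  {V : (x : M) → TangentSpace I x}

variable (I) in
/-- The expression of a vector field in the preferred chart at `x₀`. -/
noncomputable def chartField (V : (x : M) → TangentSpace I x) (x₀ : M) (z : E) : E :=
  mpullbackWithin 𝓘(ℝ, E) I (extChartAt I x₀).symm V (range I) z

variable [I.Boundaryless] [IsManifold I ∞ M]

lemma contDiffOn_chartField [CompleteSpace E]
    (hV : ContMDiff I I.tangent ∞ (fun x => (⟨x, V x⟩ : TangentBundle I M))) (x₀ : M) :
    ContDiffOn ℝ ∞ (chartField I V x₀) (extChartAt I x₀).target := by
  intro z hz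
  refine contMDiffWithinAt_vectorSpace_iff_contDiffWithinAt.mp ?_
  have hs : ContMDiffWithinAt 𝓘(ℝ, E) I ∞ (extChartAt I x₀).symm (range I) z := by
    rw [I.range_eq_univ]
    exact ((contMDiffOn_extChartAt_symm x₀).contMDiffAt
      ((isOpen_extChartAt_target x₀).mem_nhds hz)).contMDiffWithinAt
  exact ContMDiffWithinAt.mpullbackWithin_vectorField_of_eq' (n := ∞) (t := univ)
    hV.contMDiffAt.contMDiffWithinAt hs (isInvertible_mfderivWithin_extChartAt_symm hz) hz
    (isOpen_extChartAt_target x₀).uniqueMDiffOn (by simp) (by simp)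
    (extChartAt_target_subset_range x₀) rfl

omit [I.Boundaryless] in
lemma mfderiv_extChartAt_symm_chartField (x₀ : M) {z : E} (hz : z ∈ (extChartAt I x₀).target) :
    mfderivWithin 𝓘(ℝ, E) I (extChartAt I x₀).symm (range I) z
      (chartField (E := E) I V x₀ z) =
      V ((extChartAt I x₀).symm z) := by
  obtain ⟨A, hA⟩ := isInvertible_mfderivWithin_extChartAt_symm (I := I) hz
  rw [chartField, mpullbackWithin_apply, ← hA, ContinuousLinearMap.inverse_equiv]
  exact A.apply_symm_apply _

lemma hasMFDerivAt_extChartAt_symm_comp (x₀ : M) {c : ℝ → E} {t r : ℝ}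
    (hc : HasDerivAt c (r • chartField I V x₀ (c t)) t) (hm : c t ∈ (extChartAt I x₀).target) :
    HasMFDerivAt 𝓘(ℝ, ℝ) I ((extChartAt I x₀).symm ∘ c) t
      ((1 : ℝ →L[ℝ] ℝ).smulRight (r • V ((extChartAt I x₀).symm (c t)))) := by
  have h1 : HasMFDerivAt 𝓘(ℝ, E) I (extChartAt I x₀).symm (c t)
      (mfderivWithin 𝓘(ℝ, E) I (extChartAt I x₀).symm (range I) (c t)) := by
    have := (mdifferentiableWithinAt_extChartAt_symm (I := I) hm).hasMFDerivWithinAt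
    rw [← hasMFDerivWithinAt_univ]
    convert this using 1
    exact I.range_eq_univ.symm
  have h2 := h1.comp t hc.hasFDerivAt.hasMFDerivAt
  refine (congrArg (HasMFDerivAt 𝓘(ℝ, ℝ) I ((extChartAt I x₀).symm ∘ c) t) ?_).mp h2
  refine ContinuousLinearMap.ext fun a' => ?_
  let a : ℝ := a'
  have h3 : mfderivWithin 𝓘(ℝ, E) I (extChartAt I x₀).symm (range I) (c t)
      ((a * r) • chartField (E := E) I V x₀ (c t)) = (a * r) • V ((extChartAt I x₀).symm (c t)) := by
    refine (ContinuousLinearMap.map_smul (mfderivWithin 𝓘(ℝ, E) I (extChartAt I x₀).symm (range I)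
      (c t)) (a * r) _).trans ?_
    exact congrArg ((a * r) • ·) (mfderiv_extChartAt_symm_chartField x₀ hm)
  refine Eq.trans ?_ (h3.trans ?_)
  · change mfderivWithin 𝓘(ℝ, E) I (extChartAt I x₀).symm (range I) (c t)
      (a • r • chartField (E := E) I V x₀ (c t)) = _
    rw [mul_smul]
  · rw [mul_smul]; rfl

variable [FiniteDimensional ℝ E] [T2Space M]

lemma contMDiffAt_flow_zero
    (hV : ContMDiff I I.tangent ∞ (fun x => (⟨x, V x⟩ : TangentBundle I M))) (Θ : ℝ → M → M)
    (h0 : ∀ x, Θ 0 x = x) (hΘ : ∀ x, IsMIntegralCurve (I := I) (fun r => Θ r x) V) (x₀ : M) :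
    ContMDiffAt (𝓘(ℝ, ℝ).prod I) I ∞ (fun p : ℝ × M => Θ p.1 p.2) (0, x₀) := by
  have hc : CompleteSpace E := FiniteDimensional.complete ℝ E
  have hM1 : IsManifold I 1 M := IsManifold.of_le (n := ∞) (by simp)
  obtain ⟨θ, hθ, hev⟩ := exists_smooth_local_solution (chartField I V x₀)
    (isOpen_extChartAt_target x₀) (contDiffOn_chartField hV x₀) (mem_extChartAt_target x₀)
  have hlin : ContMDiffAt (𝓘(ℝ, ℝ).prod I) (𝓘(ℝ, ℝ × E)) ∞
      (fun p : ℝ × M => ((2 * p.1, extChartAt I x₀ p.2) : ℝ × E)) (0, x₀) := by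
    refine ContMDiffAt.prodMk_space ?_ ?_
    · exact ContMDiffAt.comp (0, x₀) (g := fun r : ℝ => 2 * r) (f := fun p : ℝ × M => p.1)
        (contDiff_const.mul contDiff_id).contMDiff.contMDiffAt contMDiffAt_fst
    · exact ContMDiffAt.comp (0, x₀) (f := fun p : ℝ × M => p.2) contMDiffAt_extChartAt
        contMDiffAt_snd
  have hval : (fun p : ℝ × M => ((2 * p.1, extChartAt I x₀ p.2) : ℝ × E)) (0, x₀) =
      (0, extChartAt I x₀ x₀) := by simp
  have hcont := hlin.continuousAt
  have hhalf : (1 / 2 : ℝ) ∈ Ioo (-1 : ℝ) 1 := by norm_num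
  have htar := (hev.self_of_nhds.2 (1 / 2) hhalf).2
  have hsm : ContMDiffAt (𝓘(ℝ, ℝ).prod I) I ∞
      (fun p : ℝ × M => (extChartAt I x₀).symm (θ (2 * p.1, extChartAt I x₀ p.2) (1 / 2)))
      (0, x₀) := by
    have h1 : ContMDiffAt 𝓘(ℝ, E) I ∞ (extChartAt I x₀).symm (θ (0, extChartAt I x₀ x₀) (1 / 2)) :=
      (contMDiffOn_extChartAt_symm x₀).contMDiffAt ((isOpen_extChartAt_target x₀).mem_nhds htar)
    have h2 : ContMDiffAt (𝓘(ℝ, ℝ).prod I) 𝓘(ℝ, E) ∞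
        (fun p : ℝ × M => θ (2 * p.1, extChartAt I x₀ p.2) (1 / 2)) (0, x₀) :=
      ContMDiffAt.comp_of_eq (g := fun q : ℝ × E => θ q (1 / 2)) (hθ (1 / 2)).contMDiffAt hlin hval
    exact ContMDiffAt.comp_of_eq h1 h2 (by simp)
  refine hsm.congr_of_eventuallyEq ?_
  simp only [ContinuousAt, mul_zero] at hcont
  have hev' := hcont.eventually hev
  have hsrc : ∀ᶠ p : ℝ × M in 𝓝 ((0 : ℝ), x₀), p.2 ∈ (extChartAt I x₀).source :=
    continuousAt_snd.eventually (extChartAt_source_mem_nhds (I := I) x₀)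
  filter_upwards [hev', hsrc] with p hp hps
  obtain ⟨hp0, hp1⟩ := hp
  have hγ : IsMIntegralCurve ((fun r => Θ r p.2) ∘ (· * (2 * p.1))) ((2 * p.1) • V) :=
    (hΘ p.2).comp_mul (2 * p.1)
  have hβ : IsMIntegralCurveOn ((extChartAt I x₀).symm ∘ θ (2 * p.1, extChartAt I x₀ p.2))
      ((2 * p.1) • V) (Ioo (-1) 1) := fun t ht =>
    (hasMFDerivAt_extChartAt_symm_comp x₀ (hp1 t ht).1 (hp1 t ht).2).hasMFDerivWithinAt
  have hsV : ContMDiff I I.tangent 1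
      (fun x => (⟨x, ((2 * p.1) • V) x⟩ : TangentBundle I M)) :=
    (ContMDiff.const_smul_section hV).of_le (by simp)
  have := isMIntegralCurveOn_Ioo_eqOn_of_contMDiff_boundaryless (t₀ := 0) (by norm_num) hsV
    (hγ.isMIntegralCurveOn _) hβ (by
      simp only [Function.comp_apply, zero_mul, h0, hp0, (extChartAt I x₀).left_inv hps])
  have h := this hhalf
  simp only [Function.comp_apply] at h
  rw [← h]
  congr 1
  ring

/-- The flow of a complete smooth vector field is smooth. -/
theorem contMDiff_flow
    (hV : ContMDiff I I.tangent ∞ (fun x => (⟨x, V x⟩ : TangentBundle I M))) (Θ : ℝ → M → M)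
    (h0 : ∀ x, Θ 0 x = x) (hΘ : ∀ x, IsMIntegralCurve (I := I) (fun r => Θ r x) V) :
    ContMDiff (𝓘(ℝ, ℝ).prod I) I ∞ (fun p : ℝ × M => Θ p.1 p.2) := by
  have hM1 : IsManifold I 1 M := IsManifold.of_le (n := ∞) (by simp)
  have hV1 : ContMDiff I I.tangent 1 (fun x => (⟨x, V x⟩ : TangentBundle I M)) :=
    hV.of_le (by simp)
  have hadd := flow_add hV1 h0 hΘ
  suffices H : ∀ (m : ℕ) (x : M) (r : ℝ),
      ContMDiffAt (𝓘(ℝ, ℝ).prod I) I m (fun p : ℝ × M => Θ p.1 p.2) (r, x) from fun p =>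
    contMDiffAt_infty.mpr fun m => H m p.2 p.1
  intro m x
  have hM : IsManifold I m M := IsManifold.of_le (n := ∞) (by exact_mod_cast le_top)
  have hz : ∀ y, ContMDiffAt (𝓘(ℝ, ℝ).prod I) I m (fun p : ℝ × M => Θ p.1 p.2) (0, y) :=
    fun y => (contMDiffAt_flow_zero hV Θ h0 hΘ y).of_le (by exact_mod_cast le_top)
  let S : Set ℝ := {r | ContMDiffAt (𝓘(ℝ, ℝ).prod I) I m (fun p : ℝ × M => Θ p.1 p.2) (r, x)}
  have hopen : IsOpen S := by
    rw [isOpen_iff_mem_nhds]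
    intro r hr
    have h1 : ∀ᶠ p in 𝓝 (r, x), ContMDiffAt (𝓘(ℝ, ℝ).prod I) I m
        (fun p : ℝ × M => Θ p.1 p.2) p :=
      (contMDiffAt_iff_contMDiffAt_nhds (by simp)).mp hr
    have h2 : Filter.Tendsto (fun r' : ℝ => (r', x)) (𝓝 r) (𝓝 (r, x)) :=
      (Continuous.prodMk_left x).continuousAt
    exact h2.eventually h1
  have hclosed : IsClosed S := by
    refine isClosed_of_closure_subset fun r hr => ?_
    have h1 : ∀ᶠ p in 𝓝 ((0 : ℝ), Θ r x), ContMDiffAt (𝓘(ℝ, ℝ).prod I) I m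
        (fun p : ℝ × M => Θ p.1 p.2) p :=
      (contMDiffAt_iff_contMDiffAt_nhds (by simp)).mp (hz (Θ r x))
    have h2 : Filter.Tendsto (fun r' : ℝ => (r - r', Θ r' x)) (𝓝 r) (𝓝 (0, Θ r x)) := by
      have : ContinuousAt (fun r' : ℝ => (r - r', Θ r' x)) r :=
        (continuous_const.sub continuous_id).continuousAt.prodMk (hΘ x).continuous.continuousAt
      rwa [ContinuousAt, sub_self] at this
    obtain ⟨r', hr', hS⟩ := mem_closure_iff_nhds.mp hr _ (h2.eventually h1)
    have hcomp : ContMDiffAt (𝓘(ℝ, ℝ).prod I) I m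
        (fun p : ℝ × M => Θ (p.1 - r') (Θ r' p.2)) (r, x) := by
      have ha : ContMDiffAt (𝓘(ℝ, ℝ).prod I) 𝓘(ℝ, ℝ) m (fun p : ℝ × M => p.1 - r') (r, x) :=
        ((contDiff_id.sub contDiff_const).contMDiff (n := m)).contMDiffAt.comp _ contMDiffAt_fst
      have hb : ContMDiffAt (𝓘(ℝ, ℝ).prod I) I m (fun p : ℝ × M => Θ r' p.2) (r, x) :=
        ContMDiffAt.comp (r, x) (g := fun p : ℝ × M => Θ p.1 p.2) (f := fun p : ℝ × M => (r', p.2))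
          hS (contMDiffAt_const.prodMk contMDiffAt_snd)
      exact ContMDiffAt.comp (r, x) (g := fun p : ℝ × M => Θ p.1 p.2)
        (f := fun p : ℝ × M => (p.1 - r', Θ r' p.2)) hr' (ha.prodMk hb)
    refine hcomp.congr_of_eventuallyEq (Filter.Eventually.of_forall fun p => ?_)
    change Θ p.1 p.2 = Θ (p.1 - r') (Θ r' p.2)
    rw [← hadd, sub_add_cancel]
  have huniv : S = univ := IsClopen.eq_univ ⟨hclosed, hopen⟩ ⟨0, hz x⟩
  exact fun r => (huniv.symm ▸ mem_univ r : r ∈ S)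

omit [T2Space M] in
/-- Local existence of integral curves with a uniform existence time near each point. -/
lemma eventually_exists_isMIntegralCurveOn
    (hV : ContMDiff I I.tangent ∞ (fun x => (⟨x, V x⟩ : TangentBundle I M))) (x₀ : M) :
    ∃ ε > 0, ∀ᶠ x in 𝓝 x₀, ∃ γ : ℝ → M, γ 0 = x ∧
      IsMIntegralCurveOn (I := I) γ V (Ioo (-ε) ε) := by
  have hc : CompleteSpace E := FiniteDimensional.complete ℝ E
  obtain ⟨θ, -, hev⟩ := exists_smooth_local_solution (chartField I V x₀)
    (isOpen_extChartAt_target x₀) (contDiffOn_chartField hV x₀) (mem_extChartAt_target x₀)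
  rw [nhds_prod_eq] at hev
  obtain ⟨p, hp, q, hq, hpq⟩ := Filter.eventually_prod_iff.mp hev
  obtain ⟨δ, hδ, hball⟩ := Metric.eventually_nhds_iff.mp hp
  refine ⟨δ / 2, by positivity, ?_⟩
  filter_upwards [(continuousAt_extChartAt (I := I) x₀).eventually hq,
    extChartAt_source_mem_nhds (I := I) x₀] with x hx hxs
  have hδ' : p (δ / 2) := hball (by
    rw [Real.dist_eq, sub_zero, abs_of_pos (by positivity)]; linarith)
  obtain ⟨h0, h1⟩ := hpq hδ' hx
  have hβ : IsMIntegralCurveOn ((extChartAt I x₀).symm ∘ θ (δ / 2, extChartAt I x₀ x))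
      ((δ / 2) • V) (Ioo (-1) 1) := fun t ht =>
    (hasMFDerivAt_extChartAt_symm_comp x₀ (h1 t ht).1 (h1 t ht).2).hasMFDerivWithinAt
  refine ⟨((extChartAt I x₀).symm ∘ θ (δ / 2, extChartAt I x₀ x)) ∘ (· * (δ / 2)⁻¹),
    by simp only [Function.comp_apply, zero_mul, h0, (extChartAt I x₀).left_inv hxs], ?_⟩
  have h2 := hβ.comp_mul (δ / 2)⁻¹
  rw [smul_smul, inv_mul_cancel₀ (by positivity), one_smul] at h2
  refine h2.mono fun t ht => ?_
  have hpos : 0 < δ / 2 := by positivity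
  change t * (δ / 2)⁻¹ ∈ Ioo (-1 : ℝ) 1
  rw [← div_eq_mul_inv]
  exact ⟨by rw [lt_div_iff₀ hpos]; linarith [ht.1], by rw [div_lt_iff₀ hpos]; linarith [ht.2]⟩

omit [T2Space M] in
lemma exists_uniform_isMIntegralCurveOn
    (hV : ContMDiff I I.tangent ∞ (fun x => (⟨x, V x⟩ : TangentBundle I M))) {K : Set M}
    (hK : IsCompact K) :
    ∃ ε > 0, ∀ x ∈ K, ∃ γ : ℝ → M, γ 0 = x ∧
      IsMIntegralCurveOn (I := I) γ V (Ioo (-ε) ε) := by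
  refine hK.induction_on (p := fun K => ∃ ε > 0, ∀ x ∈ K, ∃ γ : ℝ → M, γ 0 = x ∧
      IsMIntegralCurveOn (I := I) γ V (Ioo (-ε) ε)) ⟨1, one_pos, by simp⟩ ?_ ?_ ?_
  · rintro s t hst ⟨ε, hε, h⟩
    exact ⟨ε, hε, fun x hx => h x (hst hx)⟩
  · rintro s t ⟨ε, hε, h⟩ ⟨ε', hε', h'⟩
    refine ⟨min ε ε', lt_min hε hε', fun x hx => ?_⟩
    rcases hx with hx | hx
    · obtain ⟨γ, h0, h1⟩ := h x hx
      exact ⟨γ, h0, h1.mono (Ioo_subset_Ioo (neg_le_neg (min_le_left _ _)) (min_le_left _ _))⟩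
    · obtain ⟨γ, h0, h1⟩ := h' x hx
      exact ⟨γ, h0, h1.mono (Ioo_subset_Ioo (neg_le_neg (min_le_right _ _)) (min_le_right _ _))⟩
  · intro x _
    obtain ⟨ε, hε, h⟩ := eventually_exists_isMIntegralCurveOn hV x
    exact ⟨_, mem_nhdsWithin_of_mem_nhds h, ε, hε, fun y hy => hy⟩

omit [FiniteDimensional ℝ E] in
lemma exists_extension_of_isMIntegralCurveOn {γ : ℝ → M} {a ε : ℝ}
    (hV : ContMDiff I I.tangent 1 (fun x => (⟨x, V x⟩ : TangentBundle I M)))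
    (hγ : IsMIntegralCurveOn (I := I) γ V (Ioo (-a) a)) (hε : 0 < ε) (ha : ε / 2 ≤ a)
    (hex : ∀ t ∈ Ioo (-a) a, ∃ γ' : ℝ → M, γ' 0 = γ t ∧
      IsMIntegralCurveOn (I := I) γ' V (Ioo (-ε) ε)) :
    ∃ γ' : ℝ → M, γ' 0 = γ 0 ∧ IsMIntegralCurveOn (I := I) γ' V (Ioo (-(a + ε / 2)) (a + ε / 2)) := by
  have hM1 : IsManifold I 1 M := IsManifold.of_le (n := ∞) (by simp)
  set s := a - ε / 4 with hs
  obtain ⟨γ₁, h₁, hγ₁⟩ := hex (-s) ⟨by linarith, by linarith⟩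
  obtain ⟨γ₂, h₂, hγ₂⟩ := hex s ⟨by linarith, by linarith⟩
  replace hγ₁ := hγ₁.comp_add s
  replace hγ₂ := hγ₂.comp_add (-s)
  have e₁ : {t | t + s ∈ Ioo (-ε) ε} = Ioo (-ε - s) (ε - s) := by
    ext t; simp only [mem_ofPred_eq, mem_Ioo]; constructor <;> rintro ⟨_, _⟩ <;> constructor <;> linarith
  have e₂ : {t | t + -s ∈ Ioo (-ε) ε} = Ioo (s - ε) (s + ε) := by
    ext t; simp only [mem_ofPred_eq, mem_Ioo]; constructor <;> rintro ⟨_, _⟩ <;> constructor <;> linarith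
  rw [e₁] at hγ₁
  rw [e₂] at hγ₂
  have hleft := (isMIntegralCurveOn_piecewise (t₀ := -s) hV hγ hγ₁
    ⟨⟨by linarith, by linarith⟩, ⟨by linarith, by linarith⟩⟩ (by simp [h₁])).mono
    (s' := Ioo (-(a + ε / 2)) a)
    (union_comm _ _ ▸ Ioo_subset_Ioo_union_Ioo (by linarith) (by linarith) le_rfl)
  have hright := (isMIntegralCurveOn_piecewise (t₀ := s) hV hleft hγ₂
    ⟨⟨by linarith, by linarith⟩, ⟨by linarith, by linarith⟩⟩
    (by rw [piecewise, if_pos ⟨by linarith, by linarith⟩]; simp [h₂])).mono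
    (s' := Ioo (-(a + ε / 2)) (a + ε / 2))
    (Ioo_subset_Ioo_union_Ioo le_rfl (by linarith) (by linarith))
  refine ⟨_, ?_, hright⟩
  rw [piecewise, if_pos ⟨by linarith, by linarith⟩, piecewise, if_pos ⟨by linarith, by linarith⟩]

/-- A smooth vector field whose integral curves through `x` are confined to a compact set during
bounded times has a global integral curve through `x`. -/
theorem exists_isMIntegralCurve_of_confined
    (hV : ContMDiff I I.tangent ∞ (fun x => (⟨x, V x⟩ : TangentBundle I M))) (x : M)
    (h : ∀ T > 0, ∃ K : Set M, IsCompact K ∧ x ∈ K ∧ ∀ (γ : ℝ → M) (a : ℝ), a ≤ T → γ 0 = x →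
      IsMIntegralCurveOn (I := I) γ V (Ioo (-a) a) → ∀ t ∈ Ioo (-a) a, γ t ∈ K) :
    ∃ γ : ℝ → M, γ 0 = x ∧ IsMIntegralCurve (I := I) γ V := by
  have hM1 : IsManifold I 1 M := IsManifold.of_le (n := ∞) (by simp)
  have hV1 : ContMDiff I I.tangent 1 (fun x => (⟨x, V x⟩ : TangentBundle I M)) :=
    hV.of_le (by simp)
  refine (exists_isMIntegralCurve_iff_exists_isMIntegralCurveOn_Ioo hV1 x).mpr fun T => ?_
  rcases le_or_gt T 0 with hT | hT
  · exact ⟨fun _ => x, rfl, fun t ht => by linarith [ht.1, ht.2]⟩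
  obtain ⟨K, hK, hxK, hconf⟩ := h T hT
  obtain ⟨ε, hε, hex⟩ := exists_uniform_isMIntegralCurveOn hV hK
  have key : ∀ k : ℕ, ∃ γ : ℝ → M, γ 0 = x ∧ IsMIntegralCurveOn (I := I) γ V
      (Ioo (-(min T ((k + 1) * (ε / 2)))) (min T ((k + 1) * (ε / 2)))) := by
    intro k
    induction k with
    | zero =>
      obtain ⟨γ, h0, hγ⟩ := hex x hxK
      have hle : min T (((0 : ℕ) + 1) * (ε / 2)) ≤ ε := by
        refine (min_le_right _ _).trans ?_
        norm_num
        linarith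
      exact ⟨γ, h0, hγ.mono (Ioo_subset_Ioo (neg_le_neg hle) hle)⟩
    | succ k ih =>
      obtain ⟨γ, h0, hγ⟩ := ih
      rcases le_or_gt T ((k + 1) * (ε / 2)) with hTk | hTk
      · have e : min T (((k + 1 : ℕ) + 1) * (ε / 2)) = min T ((k + 1) * (ε / 2)) := by
          rw [min_eq_left hTk, min_eq_left]
          push_cast
          nlinarith
        exact ⟨γ, h0, by rw [e]; exact hγ⟩
      · rw [min_eq_right hTk.le] at hγ
        have hk : (0 : ℝ) ≤ k := k.cast_nonneg
        obtain ⟨γ', h0', hγ'⟩ := exists_extension_of_isMIntegralCurveOn hV1 hγ hε (by nlinarith)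
          (fun t ht => hex _ (hconf γ _ hTk.le h0 hγ t ht))
        have hle : min T (((k + 1 : ℕ) + 1) * (ε / 2)) ≤ (k + 1) * (ε / 2) + ε / 2 := by
          refine (min_le_right _ _).trans ?_
          push_cast
          linarith
        exact ⟨γ', h0'.trans h0, hγ'.mono (Ioo_subset_Ioo (neg_le_neg hle) hle)⟩
  obtain ⟨k, hk⟩ := exists_nat_ge (T / (ε / 2))
  have hT' : min T ((k + 1) * (ε / 2)) = T := by
    rw [div_le_iff₀ (by positivity)] at hk
    exact min_eq_left (by linarith)
  have := key k
  rwa [hT'] at this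

end ManifoldFlow

section ChartExpressions

variable {E : Type} [NormedAddCommGroup E] [NormedSpace ℝ E]
  {H : Type*} [TopologicalSpace H] {I : ModelWithCorners ℝ E H} [I.Boundaryless]
  {M : Type*} [TopologicalSpace M] [ChartedSpace H M] [IsManifold I ∞ M]
  {V W : (x : M) → TangentSpace I x}

omit [IsManifold I ∞ M] in
lemma chartField_eq_mpullback (x₀ : M) :
    chartField I V x₀ = mpullback 𝓘(ℝ, E) I (extChartAt I x₀).symm V := by
  funext z
  rw [← mpullbackWithin_univ, ← I.range_eq_univ]
  rfl

lemma hasMFDerivAt_extChartAt_symm (x₀ : M) {z : E} (hz : z ∈ (extChartAt I x₀).target) :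
    HasMFDerivAt 𝓘(ℝ, E) I (extChartAt I x₀).symm z
      (mfderiv 𝓘(ℝ, E) I (extChartAt I x₀).symm z) := by
  have := (mdifferentiableWithinAt_extChartAt_symm (I := I) hz)
  rw [I.range_eq_univ, mdifferentiableWithinAt_univ] at this
  exact this.hasMFDerivAt

lemma isInvertible_mfderiv_extChartAt_symm (x₀ : M) {z : E} (hz : z ∈ (extChartAt I x₀).target) :
    (mfderiv 𝓘(ℝ, E) I (extChartAt I x₀).symm z).IsInvertible := by
  have := isInvertible_mfderivWithin_extChartAt_symm (I := I) hz
  rwa [I.range_eq_univ, mfderivWithin_univ] at this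

lemma mfderiv_symm_chartField (x₀ : M) {z : E} (hz : z ∈ (extChartAt I x₀).target) :
    mfderiv 𝓘(ℝ, E) I (extChartAt I x₀).symm z (chartField (E := E) I V x₀ z) =
      V ((extChartAt I x₀).symm z) := by
  have := mfderiv_extChartAt_symm_chartField (I := I) (V := V) x₀ hz
  rwa [I.range_eq_univ, mfderivWithin_univ] at this

/-- The chart expression of a Lie bracket is the Lie bracket of the chart expressions. -/
lemma chartField_mlieBracket [CompleteSpace E]
    (hV : ContMDiff I I.tangent ∞ (fun x => (⟨x, V x⟩ : TangentBundle I M)))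
    (hW : ContMDiff I I.tangent ∞ (fun x => (⟨x, W x⟩ : TangentBundle I M)))
    (x₀ : M) {z : E} (hz : z ∈ (extChartAt I x₀).target) :
    chartField I (mlieBracket I V W) x₀ z =
      lieBracket ℝ (chartField I V x₀) (chartField I W x₀) z := by
  have hI : IsManifold I (minSmoothness ℝ 3) M := IsManifold.of_le (n := ∞) (by
    simp only [minSmoothness_of_isRCLikeNormedField]; exact ENat.LEInfty.out)
  have h := mpullback_mlieBracket (I := 𝓘(ℝ, E)) (n := ∞) (f := (extChartAt I x₀).symm)
    (hV.mdifferentiable (by simp) ((extChartAt I x₀).symm z))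
    (hW.mdifferentiable (by simp) ((extChartAt I x₀).symm z))
    ((contMDiffOn_extChartAt_symm x₀).contMDiffAt ((isOpen_extChartAt_target x₀).mem_nhds hz))
    (by simp only [minSmoothness_of_isRCLikeNormedField]; exact ENat.LEInfty.out)
  rw [← mlieBracketWithin_univ (I := 𝓘(ℝ, E)), mlieBracketWithin_eq_lieBracketWithin] at h
  rw [chartField_eq_mpullback, chartField_eq_mpullback, chartField_eq_mpullback]
  exact h.trans (congrFun lieBracketWithin_univ z)

variable {T : Type} [NormedAddCommGroup T] [NormedSpace ℝ T]

/-- The chart expression of a vector field on a product of a vector space and a manifold. -/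
lemma chartField_prod (a : T × M → T) (b : (p : T × M) → TangentSpace I p.2) (p₀ : T × M)
    (τ : T) {z : E} (hz : z ∈ (extChartAt I p₀.2).target) :
    chartField (𝓘(ℝ, T).prod I)
      (fun p : T × M => (((a p, b p) : T × E) : TangentSpace (𝓘(ℝ, T).prod I) p)) p₀ (τ, z) =
      (a (τ, (extChartAt I p₀.2).symm z),
        chartField I (fun x => b (τ, x)) p₀.2 z) := by
  have hchart : extChartAt (𝓘(ℝ, T).prod I) p₀ =
      (PartialEquiv.refl T).prod (extChartAt I p₀.2) := by
    rw [extChartAt_prod, extChartAt_model_space_eq_id]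
  have hmem : (τ, z) ∈ (extChartAt (𝓘(ℝ, T).prod I) p₀).target := by
    rw [hchart]
    exact ⟨mem_univ _, hz⟩
  have hd : HasMFDerivAt 𝓘(ℝ, T × E) (𝓘(ℝ, T).prod I)
      (extChartAt (𝓘(ℝ, T).prod I) p₀).symm (τ, z)
      ((ContinuousLinearMap.fst ℝ T E).prod
        ((mfderiv 𝓘(ℝ, E) I (extChartAt I p₀.2).symm z).comp (ContinuousLinearMap.snd ℝ T E))) := by
    have h1 : HasMFDerivAt 𝓘(ℝ, T × E) 𝓘(ℝ, T) (Prod.fst : T × E → T) (τ, z)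
      (ContinuousLinearMap.fst ℝ T E) := hasFDerivAt_fst.hasMFDerivAt
    have h2 : HasMFDerivAt 𝓘(ℝ, T × E) 𝓘(ℝ, E) (Prod.snd : T × E → E) (τ, z)
      (ContinuousLinearMap.snd ℝ T E) := hasFDerivAt_snd.hasMFDerivAt
    have h3 := HasMFDerivAt.comp (τ, z) (hasMFDerivAt_extChartAt_symm (I := I) p₀.2 hz) h2
    have h4 := h1.prodMk h3
    have e : ⇑(extChartAt (𝓘(ℝ, T).prod I) p₀).symm =
        fun q : T × E => (q.1, (extChartAt I p₀.2).symm q.2) := by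
      rw [hchart]; rfl
    rw [e]
    exact h4
  have hinj : Function.Injective (mfderiv 𝓘(ℝ, T × E) (𝓘(ℝ, T).prod I)
      (extChartAt (𝓘(ℝ, T).prod I) p₀).symm (τ, z)) := by
    obtain ⟨A, hA⟩ := isInvertible_mfderiv_extChartAt_symm p₀ hmem
    rw [← hA]
    exact A.injective
  apply hinj
  refine (mfderiv_symm_chartField p₀ hmem).trans
    (Eq.trans ?_ (DFunLike.congr_fun hd.mfderiv _).symm)
  have e : (extChartAt (𝓘(ℝ, T).prod I) p₀).symm (τ, z) = (τ, (extChartAt I p₀.2).symm z) := by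
    rw [hchart]; rfl
  have h5 := mfderiv_symm_chartField (V := fun x => b (τ, x)) p₀.2 hz
  exact (congrArg (fun p : T × M => ((a p, b p) : T × E)) e).trans (Prod.ext rfl h5.symm)

end ChartExpressions

section ProductFields

variable {E E' : Type*} [NormedAddCommGroup E] [NormedSpace ℝ E]
  [NormedAddCommGroup E'] [NormedSpace ℝ E']
  {H H' : Type*} [TopologicalSpace H] [TopologicalSpace H'] {I : ModelWithCorners ℝ E H}
  {I' : ModelWithCorners ℝ E' H'}
  {M M' : Type*} [TopologicalSpace M] [ChartedSpace H M] [TopologicalSpace M'] [ChartedSpace H' M']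
  [IsManifold I ∞ M] [IsManifold I' ∞ M']

lemma contMDiff_prod_along {F : Type*} [NormedAddCommGroup F] [NormedSpace ℝ F] {G : Type*}
    [TopologicalSpace G] {J : ModelWithCorners ℝ F G} {L : Type*} [TopologicalSpace L]
    [ChartedSpace G L] {f : L → M} {f' : L → M'}
    {a : (p : L) → TangentSpace I (f p)} {b : (p : L) → TangentSpace I' (f' p)}
    (ha : ContMDiff J I.tangent ∞ (fun p => (⟨f p, a p⟩ : TangentBundle I M)))
    (hb : ContMDiff J I'.tangent ∞ (fun p => (⟨f' p, b p⟩ : TangentBundle I' M'))) :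
    ContMDiff J (I.prod I').tangent ∞ (fun p =>
      (⟨(f p, f' p), ((a p, b p) : E × E')⟩ : TangentBundle (I.prod I') (M × M'))) := by
  have h1 : IsManifold I 1 M := IsManifold.of_le (n := ∞) (by simp)
  have h2 : IsManifold I' 1 M' := IsManifold.of_le (n := ∞) (by simp)
  exact (contMDiff_equivTangentBundleProd_symm (I := I) (I' := I') (M := M) (M' := M') (n := ∞)).comp
    (ha.prodMk hb)

omit [IsManifold I ∞ M] in
lemma contMDiff_const_field {F : Type*} [NormedAddCommGroup F] [NormedSpace ℝ F] {f : M → F}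
    (hf : ContMDiff I 𝓘(ℝ, F) ∞ f) {a : (p : M) → TangentSpace 𝓘(ℝ, F) (f p)}
    (ha : ContMDiff I 𝓘(ℝ, F) ∞ (fun p => (a p : F))) :
    ContMDiff I 𝓘(ℝ, F).tangent ∞ (fun p => (⟨f p, a p⟩ : TangentBundle 𝓘(ℝ, F) F)) := by
  intro p
  rw [Bundle.contMDiffAt_totalSpace]
  refine ⟨hf p, ?_⟩
  simpa using ha p

end ProductFields

section Fields

variable {s n : ℕ} {N : Type*} [TopologicalSpace N]
  [ChartedSpace (EuclideanSpace ℝ (Fin n)) N] [IsManifold (𝓡 n) ∞ N]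

lemma PolyField.contMDiff_auton (X : PolyField s n N) (π : Fin s) :
    ContMDiff ((𝓡 s).prod (𝓡 n)) ((𝓡 s).prod (𝓡 n)).tangent ∞
      (fun p : Time s × N =>
        (⟨p, X.auton π p⟩ : TangentBundle ((𝓡 s).prod (𝓡 n)) (Time s × N))) :=
  contMDiff_prod_along (contMDiff_const_field contMDiff_fst contMDiff_const) (X.smooth π)

lemma PolyField.chartField_auton (X : PolyField s n N) (π : Fin s) (p₀ : Time s × N) (τ : Time s)
    {z : EuclideanSpace ℝ (Fin n)} (hz : z ∈ (extChartAt (𝓡 n) p₀.2).target) :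
    chartField ((𝓡 s).prod (𝓡 n)) (X.auton π) p₀ (τ, z) =
      (dirT π, chartField (𝓡 n) (X.vec π τ) p₀.2 z) :=
  chartField_prod (fun _ => dirT π) (fun p => X.vec π p.1 p.2) p₀ τ hz

/-- The zero polyvector field. -/
def zeroField (s n : ℕ) (N : Type*) [TopologicalSpace N]
    [ChartedSpace (EuclideanSpace ℝ (Fin n)) N] [IsManifold (𝓡 n) ∞ N] : PolyField s n N where
  vec _ _ _ := 0
  smooth _ := (Bundle.contMDiff_zeroSection ℝ (TangentSpace (𝓡 n) : N → Type _)).comp contMDiff_snd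

lemma isIntegrable_zeroField : (zeroField s n N).IsIntegrable := by
  intro π ν p
  have hmem := mem_extChartAt_target (I := (𝓡 s).prod (𝓡 n)) p
  have h := chartField_mlieBracket ((zeroField s n N).contMDiff_auton π)
    ((zeroField s n N).contMDiff_auton ν) p hmem
  have hconst : ∀ μ : Fin s, chartField ((𝓡 s).prod (𝓡 n)) ((zeroField s n N).auton μ) p
      =ᶠ[𝓝 (extChartAt ((𝓡 s).prod (𝓡 n)) p p)]
        fun _ => ((dirT μ, 0) : Time s × EuclideanSpace ℝ (Fin n)) := by
    intro μ
    filter_upwards [(isOpen_extChartAt_target (I := (𝓡 s).prod (𝓡 n)) p).mem_nhds hmem] with q hq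
    rw [extChartAt_prod] at hq
    have := (zeroField s n N).chartField_auton μ p q.1 hq.2
    refine this.trans (Prod.ext rfl ?_)
    change mpullbackWithin _ _ _ (0 : (x : N) → TangentSpace (𝓡 n) x) _ _ = _
    rw [mpullbackWithin_zero]
    rfl
  have h0 : lieBracket ℝ (chartField ((𝓡 s).prod (𝓡 n)) ((zeroField s n N).auton π) p)
      (chartField ((𝓡 s).prod (𝓡 n)) ((zeroField s n N).auton ν) p)
      (extChartAt ((𝓡 s).prod (𝓡 n)) p p) = 0 := by
    rw [(hconst π).lieBracket_vectorField_eq (hconst ν)]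
    simp [lieBracket]
  have h1 := mfderiv_symm_chartField (V := mlieBracket ((𝓡 s).prod (𝓡 n))
    ((zeroField s n N).auton π) ((zeroField s n N).auton ν)) p hmem
  rw [h, h0] at h1
  have h2 := h1.symm.trans (ContinuousLinearMap.map_zero _)
  rwa [extChartAt_to_inv] at h2

end Fields

section GeneratedField

variable {s n : ℕ} {N : Type*} [TopologicalSpace N]
  [ChartedSpace (EuclideanSpace ℝ (Fin n)) N] [IsManifold (𝓡 n) ∞ N] {t₀ : Time s}

/-- The autonomisation `(t, x) ↦ (t, g_t x)`. -/
def GenFlow.toFun (g : GenFlow s n N t₀) (p : Time s × N) : Time s × N := (p.1, g.diffeo p.1 p.2)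

/-- The inverse autonomisation `(t, y) ↦ (t, g_t⁻¹ y)`. -/
def GenFlow.invFun (g : GenFlow s n N t₀) (p : Time s × N) : Time s × N :=
  (p.1, (g.diffeo p.1).symm p.2)

lemma GenFlow.contMDiff_toFun (g : GenFlow s n N t₀) :
    ContMDiff ((𝓡 s).prod (𝓡 n)) ((𝓡 s).prod (𝓡 n)) ∞ g.toFun :=
  contMDiff_fst.prodMk g.smooth

lemma GenFlow.contMDiff_invFun (g : GenFlow s n N t₀) :
    ContMDiff ((𝓡 s).prod (𝓡 n)) ((𝓡 s).prod (𝓡 n)) ∞ g.invFun :=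
  contMDiff_fst.prodMk g.smooth_symm

lemma GenFlow.toFun_invFun (g : GenFlow s n N t₀) (p : Time s × N) : g.toFun (g.invFun p) = p :=
  Prod.ext rfl ((g.diffeo p.1).apply_symm_apply p.2)

lemma GenFlow.invFun_toFun (g : GenFlow s n N t₀) (p : Time s × N) : g.invFun (g.toFun p) = p :=
  Prod.ext rfl ((g.diffeo p.1).symm_apply_apply p.2)

/-- The value of `∂g_t/∂t_π` at `x`, as a vector of the model space. -/
def GenFlow.velocity (g : GenFlow s n N t₀) (π : Fin s) (t : Time s) (x : N) :
    EuclideanSpace ℝ (Fin n) :=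
  mfderiv (𝓡 s) (𝓡 n) (fun τ : Time s => g.diffeo τ x) t (dirT π : Time s)

lemma GenFlow.mdifferentiableAt_uncurry (g : GenFlow s n N t₀) (p : Time s × N) :
    MDifferentiableAt ((𝓡 s).prod (𝓡 n)) (𝓡 n) (fun p : Time s × N => g.diffeo p.1 p.2) p :=
  g.smooth.mdifferentiable (by simp) p

lemma GenFlow.hasMFDerivAt_slice (g : GenFlow s n N t₀) (t : Time s) (x : N) :
    HasMFDerivAt (𝓡 s) (𝓡 n) (fun τ : Time s => g.diffeo τ x) t
      ((mfderiv ((𝓡 s).prod (𝓡 n)) (𝓡 n) (fun p : Time s × N => g.diffeo p.1 p.2) (t, x)).comp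
        ((ContinuousLinearMap.id ℝ (TangentSpace (𝓡 s) t)).prod
          (0 : TangentSpace (𝓡 s) t →L[ℝ] TangentSpace (𝓡 n) x))) := by
  have h1 : HasMFDerivAt (𝓡 s) ((𝓡 s).prod (𝓡 n)) (fun τ : Time s => (τ, x)) t
      ((ContinuousLinearMap.id ℝ (TangentSpace (𝓡 s) t)).prod
          (0 : TangentSpace (𝓡 s) t →L[ℝ] TangentSpace (𝓡 n) x)) :=
    (hasMFDerivAt_id t).prodMk (hasMFDerivAt_const x t)
  exact HasMFDerivAt.comp t (g := fun p : Time s × N => g.diffeo p.1 p.2)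
    (g.mdifferentiableAt_uncurry (t, x)).hasMFDerivAt h1

lemma GenFlow.velocity_eq (g : GenFlow s n N t₀) (π : Fin s) (t : Time s) (x : N) :
    g.velocity π t x = mfderiv ((𝓡 s).prod (𝓡 n)) (𝓡 n) (fun p : Time s × N => g.diffeo p.1 p.2)
      (t, x) ((dirT π, 0) : Time s × EuclideanSpace ℝ (Fin n)) :=
  DFunLike.congr_fun (g.hasMFDerivAt_slice t x).mfderiv (dirT π : Time s)

omit [IsManifold (𝓡 n) ∞ N] in
lemma tangentBundle_mk_eq {x y : N} (h : x = y) (v : EuclideanSpace ℝ (Fin n)) :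
    (⟨x, v⟩ : TangentBundle (𝓡 n) N) = ⟨y, v⟩ := by
  subst h; rfl

/-- The polyvector field generated by a generalised flow. -/
def GenFlow.field (g : GenFlow s n N t₀) : PolyField s n N where
  vec π t y := g.velocity π t ((g.diffeo t).symm y)
  smooth π := by
    have h1 : ContMDiff ((𝓡 s).prod (𝓡 n)) (𝓡 n).tangent ∞ (fun p : Time s × N =>
        tangentMap ((𝓡 s).prod (𝓡 n)) (𝓡 n) (fun p : Time s × N => g.diffeo p.1 p.2)
          ⟨g.invFun p, (zeroField s n N).auton π (g.invFun p)⟩) :=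
      (g.smooth.contMDiff_tangentMap (m := ∞) (by simp)).comp
        (((zeroField s n N).contMDiff_auton π).comp g.contMDiff_invFun)
    refine h1.congr fun p => ?_
    refine (tangentBundle_mk_eq ((g.diffeo p.1).apply_symm_apply p.2).symm _).trans ?_
    rw [g.velocity_eq]
    rfl

lemma GenFlow.generates_field (g : GenFlow s n N t₀) : g.Generates g.field := fun π t => by
  funext y
  exact tangentBundle_mk_eq ((g.diffeo t).apply_symm_apply y).symm _

lemma GenFlow.field_vec_apply (g : GenFlow s n N t₀) (π : Fin s) (t : Time s) (x : N) :
    g.field.vec π t (g.diffeo t x) = g.velocity π t x :=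
  congrArg (g.velocity π t) ((g.diffeo t).symm_apply_apply x)

lemma GenFlow.mfderiv_toFun (g : GenFlow s n N t₀) (π : Fin s) (p : Time s × N) :
    mfderiv ((𝓡 s).prod (𝓡 n)) ((𝓡 s).prod (𝓡 n)) g.toFun p
      ((dirT π, 0) : Time s × EuclideanSpace ℝ (Fin n)) =
      ((dirT π, g.velocity π p.1 p.2) : Time s × EuclideanSpace ℝ (Fin n)) := by
  have h1 : HasMFDerivAt ((𝓡 s).prod (𝓡 n)) (𝓡 s) (Prod.fst : Time s × N → Time s) p _ :=
    hasMFDerivAt_fst p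
  have h2 := h1.prodMk (g.mdifferentiableAt_uncurry p).hasMFDerivAt
  refine (DFunLike.congr_fun h2.mfderiv _).trans (Prod.ext rfl ?_)
  exact (g.velocity_eq π p.1 p.2).symm

lemma GenFlow.inverse_mfderiv_invFun (g : GenFlow s n N t₀) (p : Time s × N) :
    (mfderiv ((𝓡 s).prod (𝓡 n)) ((𝓡 s).prod (𝓡 n)) g.invFun p).inverse =
      mfderiv ((𝓡 s).prod (𝓡 n)) ((𝓡 s).prod (𝓡 n)) g.toFun (g.invFun p) := by
  have hL := (g.contMDiff_toFun.mdifferentiable (by simp) (g.invFun p)).hasMFDerivAt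
  have hK := (g.contMDiff_invFun.mdifferentiable (by simp) p).hasMFDerivAt
  have hK' : HasMFDerivAt ((𝓡 s).prod (𝓡 n)) ((𝓡 s).prod (𝓡 n)) g.invFun (g.toFun (g.invFun p))
      (mfderiv ((𝓡 s).prod (𝓡 n)) ((𝓡 s).prod (𝓡 n)) g.invFun (g.toFun (g.invFun p))) :=
    (g.contMDiff_invFun.mdifferentiable (by simp) _).hasMFDerivAt
  have h1 := (HasMFDerivAt.comp p hL hK).congr_of_eventuallyEq
    (Filter.Eventually.of_forall (f := 𝓝 p) fun q => (g.toFun_invFun q).symm)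
  have h2 := (HasMFDerivAt.comp (g.invFun p) hK' hL).congr_of_eventuallyEq
    (Filter.Eventually.of_forall (f := 𝓝 (g.invFun p)) fun q => (g.invFun_toFun q).symm)
  have e1 := hasMFDerivAt_unique h1 (hasMFDerivAt_id p)
  have e2 := hasMFDerivAt_unique h2 (hasMFDerivAt_id (g.invFun p))
  rw [g.toFun_invFun] at e2
  exact ContinuousLinearMap.inverse_eq e2 e1

lemma GenFlow.field_auton (g : GenFlow s n N t₀) (π : Fin s) :
    g.field.auton π = mpullback ((𝓡 s).prod (𝓡 n)) ((𝓡 s).prod (𝓡 n)) g.invFun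
      ((zeroField s n N).auton π) := by
  funext p
  rw [mpullback_apply, g.inverse_mfderiv_invFun]
  exact (g.mfderiv_toFun π (g.invFun p)).symm

lemma GenFlow.isIntegrable_field (g : GenFlow s n N t₀) : g.field.IsIntegrable := by
  intro π ν p
  rw [g.field_auton, g.field_auton]
  have h2 : IsManifold ((𝓡 s).prod (𝓡 n)) (minSmoothness ℝ 2) (Time s × N) :=
    IsManifold.of_le (n := ∞) (by
      simp only [minSmoothness_of_isRCLikeNormedField]; exact ENat.LEInfty.out)
  have h3 : IsManifold ((𝓡 s).prod (𝓡 n)) (minSmoothness ℝ 3) (Time s × N) :=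
    IsManifold.of_le (n := ∞) (by
      simp only [minSmoothness_of_isRCLikeNormedField]; exact ENat.LEInfty.out)
  have h := mpullback_mlieBracket (f := g.invFun) (n := ∞) (x₀ := p)
    (((zeroField s n N).contMDiff_auton π).mdifferentiable (by simp) (g.invFun p))
    (((zeroField s n N).contMDiff_auton ν).mdifferentiable (by simp) (g.invFun p))
    g.contMDiff_invFun.contMDiffAt
    (by simp only [minSmoothness_of_isRCLikeNormedField]; exact ENat.LEInfty.out)
  rw [← h, mpullback_apply, isIntegrable_zeroField]
  exact ContinuousLinearMap.map_zero _

lemma GenFlow.diffeo_foot (g : GenFlow s n N t₀) (x : N) : g.diffeo t₀ x = x := by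
  rw [g.foot]; rfl

lemma GenFlow.invFun_foot (g : GenFlow s n N t₀) (x : N) : g.invFun (t₀, x) = (t₀, x) := by
  refine Prod.ext rfl ?_
  change (g.diffeo t₀).symm x = x
  rw [g.foot]; rfl

lemma eventually_nhdsSet_foot_iff {P : Time s × N → Prop} :
    (∀ᶠ p in 𝓝ˢ (({t₀} : Set (Time s)) ×ˢ (univ : Set N)), P p) ↔
      ∀ x : N, ∀ᶠ p in 𝓝 (t₀, x), P p := by
  rw [eventually_nhdsSet_iff_forall]
  constructor
  · exact fun h x => h (t₀, x) ⟨rfl, mem_univ _⟩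
  · rintro h ⟨t, x⟩ ⟨ht, -⟩
    rw [mem_singleton_iff] at ht
    subst ht
    exact h x

/-- The germ of the generated field depends only on the germ of the flow. -/
lemma GenFlow.field_germ_eq {g h : GenFlow s n N t₀} (hgh : flowSetoid s n N t₀ g h) :
    fieldSetoid s n N t₀ ⟨g.field, g.isIntegrable_field⟩ ⟨h.field, h.isIntegrable_field⟩ := by
  refine eventually_nhdsSet_foot_iff.mpr fun x => ?_
  have h1 : ∀ᶠ p in 𝓝 (t₀, x), g.diffeo p.1 p.2 = h.diffeo p.1 p.2 :=
    eventually_nhdsSet_foot_iff.mp hgh x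
  have h2 : Filter.Tendsto g.invFun (𝓝 (t₀, x)) (𝓝 (t₀, x)) := by
    have := g.contMDiff_invFun.continuous.tendsto (t₀, x)
    rwa [g.invFun_foot] at this
  filter_upwards [h2.eventually h1.eventually_nhds] with p hp π
  have h3 : (h.diffeo p.1).symm p.2 = (g.diffeo p.1).symm p.2 := by
    have e : p.2 = h.diffeo p.1 ((g.diffeo p.1).symm p.2) :=
      ((g.diffeo p.1).apply_symm_apply p.2).symm.trans hp.self_of_nhds
    exact (congrArg (h.diffeo p.1).symm e).trans ((h.diffeo p.1).symm_apply_apply _)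
  have h4 : g.velocity π p.1 ((g.diffeo p.1).symm p.2) =
      h.velocity π p.1 ((g.diffeo p.1).symm p.2) := by
    have h5 : Filter.Tendsto (fun τ : Time s => (τ, (g.diffeo p.1).symm p.2)) (𝓝 p.1)
        (𝓝 (g.invFun p)) := (Continuous.prodMk_left _).tendsto p.1
    have h6 : (fun τ : Time s => g.diffeo τ ((g.diffeo p.1).symm p.2)) =ᶠ[𝓝 p.1]
        fun τ : Time s => h.diffeo τ ((g.diffeo p.1).symm p.2) := h5.eventually hp
    exact DFunLike.congr_fun (h6.mfderiv_eq (I := 𝓡 s) (I' := 𝓡 n)) (dirT π : Time s)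
  exact h4.trans (congrArg (h.velocity π p.1) h3.symm)

end GeneratedField

section FieldsAlongMaps

variable {E E' : Type*} [NormedAddCommGroup E] [NormedSpace ℝ E]
  [NormedAddCommGroup E'] [NormedSpace ℝ E']
  {H H' : Type*} [TopologicalSpace H] [TopologicalSpace H'] {I : ModelWithCorners ℝ E H}
  {I' : ModelWithCorners ℝ E' H'}
  {M M' : Type*} [TopologicalSpace M] [ChartedSpace H M] [TopologicalSpace M'] [ChartedSpace H' M']
  [IsManifold I' ∞ M']

/-- Linear combinations, with smooth coefficients, of smooth vector fields along a map. -/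
lemma contMDiff_sum_smul_along {ι : Type*} [Fintype ι] {f : M → M'} (hf : ContMDiff I I' ∞ f)
    {c : ι → M → ℝ} (hc : ∀ i, ContMDiff I 𝓘(ℝ, ℝ) ∞ (c i))
    {w : ι → (p : M) → TangentSpace I' (f p)}
    (hw : ∀ i, ContMDiff I I'.tangent ∞ (fun p => (⟨f p, w i p⟩ : TangentBundle I' M'))) :
    ContMDiff I I'.tangent ∞ (fun p => (⟨f p, ∑ i, c i p • w i p⟩ : TangentBundle I' M')) := by
  intro p₀
  have h1 : IsManifold I' 1 M' := IsManifold.of_le (n := ∞) (by simp)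
  rw [Bundle.contMDiffAt_totalSpace]
  refine ⟨hf p₀, ?_⟩
  have hw' := fun i => (Bundle.contMDiffAt_totalSpace.mp (hw i p₀)).2
  set e := trivializationAt E' (TangentSpace I' : M' → Type _) (f p₀) with he
  have hsum : ContMDiffAt I 𝓘(ℝ, E') ∞
      (fun p => ∑ i, c i p • (e (⟨f p, w i p⟩ : TangentBundle I' M')).2) p₀ := by
    refine contMDiffAt_finsetSum fun i _ => ?_
    exact (hc i p₀).smul (hw' i)
  refine hsum.congr_of_eventuallyEq ?_
  filter_upwards [(hf p₀).continuousAt.preimage_mem_nhds (e.open_baseSet.mem_nhds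
    (FiberBundle.mem_baseSet_trivializationAt' (f p₀)))] with p hp
  have hl := e.linear ℝ hp
  exact (map_sum (hl.mk' _) _ _).trans (Finset.sum_congr rfl fun i _ => hl.map_smul _ _)

end FieldsAlongMaps

section Radial

variable {s n : ℕ} {N : Type*} [TopologicalSpace N]
  [ChartedSpace (EuclideanSpace ℝ (Fin n)) N] [IsManifold (𝓡 n) ∞ N]

/-- The contraction `∑ π, u_π X_π(t, y)`. -/
def PolyField.contract (X : PolyField s n N) (t u : Time s) (y : N) : TangentSpace (𝓡 n) y :=
  ∑ π, u π • X.vec π t y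

/-- The space of triples `(v, u, y)`: a scalar time, a direction in `ℝ^s` and a point of `N`. -/
abbrev RaySpace (s : ℕ) (N : Type*) : Type _ := ℝ × (Time s × N)

/-- The model of `RaySpace`. -/
abbrev rayModel (s n : ℕ) := 𝓘(ℝ, ℝ).prod ((𝓡 s).prod (𝓡 n))

/-- The velocity in `N` at `(v, u, y)` of the cut-off motion along the ray `v ↦ t₀ + v² u`. -/
def PolyField.rayVec (X : PolyField s n N) (f : Time s × N → ℝ) (t₀ : Time s) (v : ℝ)
    (u : Time s) (y : N) : TangentSpace (𝓡 n) y :=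
  (2 * v * f (t₀ + v ^ 2 • u, y)) • X.contract (t₀ + v ^ 2 • u) u y

/-- The vector field on `RaySpace` whose integral curves follow `X`, cut off by `f`, along the
rays `v ↦ t₀ + v² u`. -/
def PolyField.rayField (X : PolyField s n N) (f : Time s × N → ℝ) (t₀ : Time s)
    (q : RaySpace s N) : TangentSpace (rayModel s n) q :=
  ((1, (0, X.rayVec f t₀ q.1 q.2.1 q.2.2)) : ℝ × (Time s × EuclideanSpace ℝ (Fin n)))

variable (X : PolyField s n N) {f : Time s × N → ℝ} {t₀ : Time s}

omit [IsManifold (𝓡 n) ∞ N] in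
lemma contMDiff_rayPoint : ContMDiff (rayModel s n) ((𝓡 s).prod (𝓡 n)) ∞
    (fun q : RaySpace s N => (t₀ + q.1 ^ 2 • q.2.1, q.2.2)) := by
  have h1 : ContMDiff (rayModel s n) 𝓘(ℝ, ℝ) ∞ (fun q : RaySpace s N => q.1 ^ 2) :=
    (contDiff_id.pow 2).contMDiff.comp contMDiff_fst
  have h2 : ContMDiff (rayModel s n) (𝓡 s) ∞ (fun q : RaySpace s N => q.2.1) :=
    contMDiff_fst.comp contMDiff_snd
  exact (contMDiff_const.add (h1.smul h2)).prodMk (contMDiff_snd.comp contMDiff_snd)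

lemma PolyField.contMDiff_rayField (hf : ContMDiff ((𝓡 s).prod (𝓡 n)) 𝓘(ℝ, ℝ) ∞ f) :
    ContMDiff (rayModel s n) (rayModel s n).tangent ∞
      (fun q : RaySpace s N =>
        (⟨q, X.rayField f t₀ q⟩ : TangentBundle (rayModel s n) (RaySpace s N))) := by
  have hp := contMDiff_rayPoint (n := n) (N := N) (t₀ := t₀)
  have hcoord : ∀ π : Fin s, ContMDiff (rayModel s n) 𝓘(ℝ, ℝ) ∞
      (fun q : RaySpace s N => q.2.1 π) := fun π =>
    (EuclideanSpace.proj (𝕜 := ℝ) π).contDiff.contMDiff.comp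
      (contMDiff_fst.comp contMDiff_snd)
  have hv : ContMDiff (rayModel s n) 𝓘(ℝ, ℝ) ∞ (fun q : RaySpace s N => 2 * q.1) :=
    (contDiff_const.mul contDiff_id).contMDiff.comp contMDiff_fst
  have hy : ContMDiff (rayModel s n) (𝓡 n).tangent ∞ (fun q : RaySpace s N =>
      (⟨q.2.2, X.rayVec f t₀ q.1 q.2.1 q.2.2⟩ : TangentBundle (𝓡 n) N)) := by
    have := contMDiff_sum_smul_along (I := rayModel s n) (f := fun q : RaySpace s N => q.2.2)
      (contMDiff_snd.comp contMDiff_snd)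
      (c := fun π q => 2 * q.1 * f (t₀ + q.1 ^ 2 • q.2.1, q.2.2) * q.2.1 π)
      (fun π => (hv.mul (hf.comp hp)).mul (hcoord π))
      (w := fun π q => X.vec π (t₀ + q.1 ^ 2 • q.2.1) q.2.2)
      (fun π => (X.smooth π).comp hp)
    convert this using 2
    simp only [PolyField.rayVec, PolyField.contract, Finset.smul_sum, smul_smul]
  exact contMDiff_prod_along (contMDiff_const_field contMDiff_fst contMDiff_const)
    (contMDiff_prod_along (contMDiff_const_field (contMDiff_fst.comp contMDiff_snd)
      contMDiff_const) hy)

end Radial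

section Exhaustion

variable {E : Type*} [NormedAddCommGroup E] [NormedSpace ℝ E] [FiniteDimensional ℝ E]
  {H : Type*} [TopologicalSpace H] (I : ModelWithCorners ℝ E H)
  (M : Type*) [TopologicalSpace M] [ChartedSpace H M] [IsManifold I ∞ M] [T2Space M]
  [SigmaCompactSpace M]

/-- A manifold has a smooth exhaustion function. -/
lemma exists_smooth_exhaustion :
    ∃ ρ : M → ℝ, ContMDiff I 𝓘(ℝ, ℝ) ∞ ρ ∧ ∀ R : ℝ, IsCompact {x | ρ x ≤ R} := by
  have hL : LocallyCompactSpace M := Manifold.locallyCompact_of_finiteDimensional I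
  let K : CompactExhaustion M := default
  obtain ⟨ρ, hρ⟩ := exists_contMDiffMap_forall_mem_convex_of_local_const (n := ⊤) I
    (t := fun x : M => Ici (K.find x : ℝ)) (fun x => convex_Ici _) (fun x => by
      refine ⟨(K.find x : ℝ) + 1, ?_⟩
      filter_upwards [isOpen_interior.mem_nhds (K.subset_interior_succ _ (K.mem_find x))] with y hy
      have := K.mem_iff_find_le.mp (interior_subset hy)
      exact mem_Ici.mpr (by exact_mod_cast this))
  refine ⟨ρ, ρ.contMDiff, fun R => ?_⟩
  obtain ⟨k, hk⟩ := exists_nat_ge R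
  refine (K.isCompact k).of_isClosed_subset
    (isClosed_le ρ.contMDiff.continuous continuous_const) fun x hx => ?_
  refine K.mem_iff_find_le.mpr ?_
  have : (K.find x : ℝ) ≤ k := (hρ x).trans (le_trans hx hk)
  exact_mod_cast this

/-- A function which is continuous on `C × M`, with `C` compact, has a smooth bound on `M`. -/
lemma exists_smooth_bound {T : Type*} [TopologicalSpace T] {C : Set T} (hC : IsCompact C)
    {G : T × M → ℝ} (hG : Continuous G) :
    ∃ A : M → ℝ, ContMDiff I 𝓘(ℝ, ℝ) ∞ A ∧ ∀ t ∈ C, ∀ y, G (t, y) ≤ A y := by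
  obtain ⟨A, hA⟩ := exists_contMDiffMap_forall_mem_convex_of_local_const (n := ⊤) I
    (t := fun y : M => {a : ℝ | ∀ t ∈ C, G (t, y) ≤ a})
    (fun y a ha b hb α β hα hβ hαβ t ht => by
      have h1 := ha t ht
      have h2 := hb t ht
      simp only [smul_eq_mul]
      have : G (t, y) = α * G (t, y) + β * G (t, y) := by rw [← add_mul, hαβ, one_mul]
      rw [this]
      gcongr) (fun y => by
      obtain ⟨c, hc⟩ := (hC.image (hG.comp (Continuous.prodMk_left y))).bddAbove
      refine ⟨c + 1, ?_⟩
      refine hC.eventually_forall_of_forall_eventually fun t ht => ?_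
      have h1 : G (t, y) < c + 1 := lt_of_le_of_lt (hc ⟨t, ht, rfl⟩) (lt_add_one c)
      have h2 : ∀ᶠ p in 𝓝 (t, y), G p < c + 1 := hG.continuousAt.eventually (gt_mem_nhds h1)
      have h3 : Filter.Tendsto (fun z : M × T => (z.2, z.1)) (𝓝 (y, t)) (𝓝 (t, y)) :=
        continuous_swap.continuousAt
      exact (h3.eventually h2).mono fun z hz => hz.le)
  exact ⟨A, A.contMDiff, fun t ht y => hA y t ht⟩

end Exhaustion

section Cutoff

variable {s n : ℕ} {N : Type*} [TopologicalSpace N]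
  [ChartedSpace (EuclideanSpace ℝ (Fin n)) N] [IsManifold (𝓡 n) ∞ N]

/-- The derivative of `ρ` at `y` in the direction `w`. -/
def dirDeriv (ρ : N → ℝ) (y : N) (w : TangentSpace (𝓡 n) y) : ℝ := mfderiv (𝓡 n) 𝓘(ℝ, ℝ) ρ y w

omit [IsManifold (𝓡 n) ∞ N] in
lemma dirDeriv_smul (ρ : N → ℝ) (y : N) (c : ℝ) (w : TangentSpace (𝓡 n) y) :
    dirDeriv ρ y (c • w) = c * dirDeriv ρ y w :=
  (mfderiv (𝓡 n) 𝓘(ℝ, ℝ) ρ y).map_smul c w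

/-- The derivative of `ρ` along `X_π` at `p`. -/
def PolyField.lie (X : PolyField s n N) (ρ : N → ℝ) (π : Fin s) (p : Time s × N) : ℝ :=
  dirDeriv ρ p.2 (X.vec π p.1 p.2)

lemma PolyField.continuous_lie (X : PolyField s n N) {ρ : N → ℝ}
    (hρ : ContMDiff (𝓡 n) 𝓘(ℝ, ℝ) ∞ ρ) (π : Fin s) : Continuous (X.lie ρ π) := by
  have h1 := (hρ.contMDiff_tangentMap (m := ∞) (by simp)).comp (X.smooth π)
  exact ((contMDiff_snd_tangentBundle_modelSpace ℝ 𝓘(ℝ, ℝ) (n := ∞)).comp h1).continuous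

lemma PolyField.dirDeriv_contract (X : PolyField s n N) (ρ : N → ℝ) (t u : Time s) (y : N) :
    dirDeriv ρ y (X.contract t u y) = ∑ π, u π * X.lie ρ π (t, y) := by
  refine (map_sum (mfderiv (𝓡 n) 𝓘(ℝ, ℝ) ρ y) _ _).trans (Finset.sum_congr rfl fun π _ => ?_)
  exact dirDeriv_smul ρ y _ _

lemma PolyField.sq_dirDeriv_contract_le (X : PolyField s n N) (ρ : N → ℝ) (t u : Time s) (y : N) :
    dirDeriv ρ y (X.contract t u y) ^ 2 ≤
      ‖u‖ ^ 2 * ∑ π, X.lie ρ π (t, y) ^ 2 := by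
  rw [X.dirDeriv_contract, EuclideanSpace.norm_sq_eq]
  simp only [Real.norm_eq_abs, sq_abs]
  exact Finset.sum_mul_sq_le_sq_mul_sq _ _ _

variable [T2Space N] [SigmaCompactSpace N]

/-- There is a cut-off function, equal to one near `{t₀} × N`, for which the rays
`v ↦ t₀ + v² u` are followed with a bounded growth of the exhaustion function `ρ`. -/
lemma PolyField.exists_cutoff (X : PolyField s n N) (t₀ : Time s) {ρ : N → ℝ}
    (hρ : ContMDiff (𝓡 n) 𝓘(ℝ, ℝ) ∞ ρ) :
    ∃ f : Time s × N → ℝ, ContMDiff ((𝓡 s).prod (𝓡 n)) 𝓘(ℝ, ℝ) ∞ f ∧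
      (∀ x : N, ∀ᶠ p in 𝓝 (t₀, x), f p = 1) ∧
      ∀ v u y, |dirDeriv ρ y (X.rayVec f t₀ v u y)| ≤ 2 * √‖u‖ := by
  let D : Time s × N → ℝ := fun p => ∑ π, X.lie ρ π p ^ 2
  have hD : Continuous D := continuous_finsetSum _ fun π _ => (X.continuous_lie hρ π).pow 2
  have hD0 : ∀ p, 0 ≤ D p := fun p => Finset.sum_nonneg fun π _ => sq_nonneg _
  obtain ⟨A, hA, hAb⟩ := exists_smooth_bound (𝓡 n) N (isCompact_closedBall t₀ (1 : ℝ))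
    (G := fun p : Time s × N => 2 + 2 * D p ^ 2) (by fun_prop)
  have hA2 : ∀ y, 2 ≤ A y := fun y => by
    have := hAb t₀ (Metric.mem_closedBall_self zero_le_one) y
    have h2 : 0 ≤ D (t₀, y) ^ 2 := sq_nonneg _
    linarith
  have hsq : ContMDiff ((𝓡 s).prod (𝓡 n)) 𝓘(ℝ, ℝ) ∞ (fun p : Time s × N => ‖p.1 - t₀‖ ^ 2) :=
    ((contDiff_norm_sq ℝ).comp (contDiff_id.sub contDiff_const)).contMDiff.comp contMDiff_fst
  have hA' : ContMDiff ((𝓡 s).prod (𝓡 n)) 𝓘(ℝ, ℝ) ∞ (fun p : Time s × N => A p.2) :=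
    hA.comp contMDiff_snd
  refine ⟨fun p => Real.smoothTransition (2 - A p.2 * ‖p.1 - t₀‖ ^ 2), ?_, fun x => ?_,
    fun v u y => ?_⟩
  · exact (Real.smoothTransition.contDiff (n := ⊤)).contMDiff.comp
      (contMDiff_const.sub (hA'.mul hsq))
  · have hc : ContinuousAt (fun p : Time s × N => A p.2 * ‖p.1 - t₀‖ ^ 2) (t₀, x) :=
      (hA'.mul hsq).continuous.continuousAt
    have h0 : A x * ‖t₀ - t₀‖ ^ 2 < 1 := by simp
    filter_upwards [hc.eventually (gt_mem_nhds h0)] with p hp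
    exact Real.smoothTransition.one_of_one_le (by linarith)
  · set τ := t₀ + v ^ 2 • u with hτ
    set φ := Real.smoothTransition (2 - A y * ‖τ - t₀‖ ^ 2) with hφ
    have hval : dirDeriv ρ y (X.rayVec
        (fun p => Real.smoothTransition (2 - A p.2 * ‖p.1 - t₀‖ ^ 2)) t₀ v u y) =
        2 * v * φ * dirDeriv ρ y (X.contract τ u y) :=
      dirDeriv_smul ρ y _ _
    rw [hval]
    refine abs_le_of_sq_le_sq ?_ (by positivity)
    have hc := X.sq_dirDeriv_contract_le ρ τ u y
    have hφ0 : 0 ≤ φ := Real.smoothTransition.nonneg _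
    have hφ1 : φ ≤ 1 := Real.smoothTransition.le_one _
    have hnorm : ‖τ - t₀‖ = v ^ 2 * ‖u‖ := by
      rw [hτ, add_sub_cancel_left, norm_smul, Real.norm_eq_abs, abs_of_nonneg (sq_nonneg v)]
    rcases eq_or_ne φ 0 with h0 | h0
    · rw [h0]
      have := norm_nonneg u
      simp only [mul_zero, zero_mul, ne_eq, OfNat.ofNat_ne_zero, not_false_eq_true, zero_pow]
      positivity
    have hlt : A y * ‖τ - t₀‖ ^ 2 < 2 := by
      by_contra hge
      exact h0 (Real.smoothTransition.zero_of_nonpos (by linarith [not_lt.mp hge]))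
    have hle1 : ‖τ - t₀‖ ≤ 1 := by
      by_contra hgt
      nlinarith [hA2 y, not_le.mp hgt]
    have hAy := hAb τ (by rwa [Metric.mem_closedBall, dist_eq_norm]) y
    change 2 + 2 * D (τ, y) ^ 2 ≤ A y at hAy
    have hD1 : D (τ, y) * ‖τ - t₀‖ ≤ 1 := by
      refine le_of_sq_le_sq ?_ zero_le_one
      rw [mul_pow]
      nlinarith [sq_nonneg ‖τ - t₀‖]
    rw [hnorm] at hD1
    rw [mul_pow 2 (√‖u‖), Real.sq_sqrt (norm_nonneg u), mul_pow, mul_pow]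
    change _ ≤ ‖u‖ ^ 2 * D (τ, y) at hc
    have hφ2 : φ ^ 2 ≤ 1 := by nlinarith
    calc (2 * v) ^ 2 * φ ^ 2 * _ ^ 2 ≤ (2 * v) ^ 2 * 1 * (‖u‖ ^ 2 * D (τ, y)) := by gcongr
      _ = 4 * ‖u‖ * (D (τ, y) * (v ^ 2 * ‖u‖)) := by ring
      _ ≤ 4 * ‖u‖ * 1 := by gcongr
      _ = 2 ^ 2 * ‖u‖ := by ring

end Cutoff

section Rays

variable {s n : ℕ} {N : Type*} [TopologicalSpace N]
  [ChartedSpace (EuclideanSpace ℝ (Fin n)) N] [IsManifold (𝓡 n) ∞ N]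
  (X : PolyField s n N) {f : Time s × N → ℝ} {t₀ : Time s}

lemma PolyField.hasMFDerivAt_rayField {u : Time s} {y : ℝ → N} {w c : ℝ}
    (h : HasMFDerivAt 𝓘(ℝ, ℝ) (𝓡 n) y w
      ((1 : ℝ →L[ℝ] ℝ).smulRight (X.rayVec f t₀ (w + c) u (y w)))) :
    HasMFDerivAt 𝓘(ℝ, ℝ) (rayModel s n) (fun w => ((w + c, (u, y w)) : RaySpace s N)) w
      ((1 : ℝ →L[ℝ] ℝ).smulRight (X.rayField f t₀ (w + c, (u, y w)))) := by
  have h1 : HasMFDerivAt 𝓘(ℝ, ℝ) 𝓘(ℝ, ℝ) (fun w : ℝ => w + c) w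
      ((1 : ℝ →L[ℝ] ℝ).smulRight (1 : ℝ)) :=
    ((hasDerivAt_id w).add_const c).hasFDerivAt.hasMFDerivAt
  have h2 : HasMFDerivAt 𝓘(ℝ, ℝ) (𝓡 s) (fun _ : ℝ => u) w
      ((1 : ℝ →L[ℝ] ℝ).smulRight (0 : Time s)) :=
    (hasDerivAt_const w u).hasFDerivAt.hasMFDerivAt
  have h3 := h1.prodMk (h2.prodMk h)
  exact h3

lemma PolyField.ray_components {γ : ℝ → RaySpace s N} {S : Set ℝ} (hS : IsOpen S)
    (hS' : IsPreconnected S) (h0 : (0 : ℝ) ∈ S)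
    (hγ : IsMIntegralCurveOn (I := rayModel s n) γ (X.rayField f t₀) S) {w : ℝ} (hw : w ∈ S) :
    (γ w).1 = (γ 0).1 + w ∧ (γ w).2.1 = (γ 0).2.1 ∧
      HasMFDerivAt 𝓘(ℝ, ℝ) (𝓡 n) (fun w => (γ w).2.2) w
        ((1 : ℝ →L[ℝ] ℝ).smulRight (X.rayVec f t₀ (γ w).1 (γ w).2.1 (γ w).2.2)) := by
  have hd : ∀ w ∈ S, HasMFDerivAt 𝓘(ℝ, ℝ) (rayModel s n) γ w
      ((1 : ℝ →L[ℝ] ℝ).smulRight (X.rayField f t₀ (γ w))) := fun w hw =>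
    (hγ w hw).hasMFDerivAt (hS.mem_nhds hw)
  have h1 : ∀ w ∈ S, HasDerivAt (fun w => (γ w).1) 1 w := fun w hw =>
    HasMFDerivAt.hasFDerivAt (HasMFDerivAt.comp w (hasMFDerivAt_fst (γ w)) (hd w hw))
  have h2 : ∀ w ∈ S, HasDerivAt (fun w => (γ w).2.1) 0 w := fun w hw =>
    HasMFDerivAt.hasFDerivAt (HasMFDerivAt.comp w (hasMFDerivAt_fst (γ w).2)
      (HasMFDerivAt.comp w (hasMFDerivAt_snd (γ w)) (hd w hw)))
  have h3 : HasMFDerivAt 𝓘(ℝ, ℝ) (𝓡 n) (fun w => (γ w).2.2) w _ :=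
    HasMFDerivAt.comp w (hasMFDerivAt_snd (γ w).2)
      (HasMFDerivAt.comp w (hasMFDerivAt_snd (γ w)) (hd w hw))
  refine ⟨?_, ?_, h3⟩
  · have h4 : ∀ w ∈ S, HasDerivAt (fun w => (γ w).1 - w) 0 w := fun w hw => by
      exact ((h1 w hw).sub (hasDerivAt_id w)).congr_deriv (sub_self _)
    have := hS.is_const_of_deriv_eq_zero hS'
      (fun w hw => (h4 w hw).differentiableAt.differentiableWithinAt)
      (fun w hw => (h4 w hw).deriv) hw h0
    simp only [sub_zero] at this
    linarith
  · exact hS.is_const_of_deriv_eq_zero hS'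
      (fun w hw => (h2 w hw).differentiableAt.differentiableWithinAt)
      (fun w hw => (h2 w hw).deriv) hw h0

omit [IsManifold (𝓡 n) ∞ N] in
lemma hasDerivAt_comp_curve {ρ : N → ℝ} {y : ℝ → N} {w : ℝ} {v : TangentSpace (𝓡 n) (y w)}
    (hρ : MDifferentiableAt (𝓡 n) 𝓘(ℝ, ℝ) ρ (y w))
    (hy : HasMFDerivAt 𝓘(ℝ, ℝ) (𝓡 n) y w ((1 : ℝ →L[ℝ] ℝ).smulRight v)) :
    HasDerivAt (fun w => ρ (y w)) (dirDeriv ρ (y w) v) w := by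
  have h1 := HasMFDerivAt.hasFDerivAt (HasMFDerivAt.comp w hρ.hasMFDerivAt hy)
  have h2 : HasFDerivAt (fun w => ρ (y w))
      ((1 : ℝ →L[ℝ] ℝ).smulRight (dirDeriv ρ (y w) v)) w := by
    refine (congrArg (fun L : ℝ →L[ℝ] ℝ => HasFDerivAt (fun w => ρ (y w)) L w) ?_).mp h1
    exact ContinuousLinearMap.ext fun a : ℝ => dirDeriv_smul ρ (y w) a v
  exact h2.hasDerivAt.congr_deriv (one_smul ℝ _)

/-- Integral curves of the cut-off ray field exist for all times. -/
lemma PolyField.exists_isMIntegralCurve_rayField [T2Space N] {ρ : N → ℝ}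
    (hf : ContMDiff ((𝓡 s).prod (𝓡 n)) 𝓘(ℝ, ℝ) ∞ f)
    (hρ : ContMDiff (𝓡 n) 𝓘(ℝ, ℝ) ∞ ρ) (hρc : ∀ R : ℝ, IsCompact {x | ρ x ≤ R})
    (hb : ∀ v u y, |dirDeriv ρ y (X.rayVec f t₀ v u y)| ≤ 2 * √‖u‖) (q : RaySpace s N) :
    ∃ γ : ℝ → RaySpace s N, γ 0 = q ∧
      IsMIntegralCurve (I := rayModel s n) γ (X.rayField f t₀) := by
  refine exists_isMIntegralCurve_of_confined (X.contMDiff_rayField hf) q fun T hT => ?_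
  refine ⟨Icc (q.1 - T) (q.1 + T) ×ˢ ({q.2.1} ×ˢ {x | ρ x ≤ ρ q.2.2 + 2 * √‖q.2.1‖ * T}),
    isCompact_Icc.prod (isCompact_singleton.prod (hρc _)), ?_, ?_⟩
  · refine ⟨⟨by linarith, by linarith⟩, rfl, ?_⟩
    have := Real.sqrt_nonneg ‖q.2.1‖
    change ρ q.2.2 ≤ ρ q.2.2 + 2 * √‖q.2.1‖ * T
    nlinarith
  · intro γ a ha h0 hγ t ht
    have h00 : (0 : ℝ) ∈ Ioo (-a) a := ⟨by linarith [ht.1, ht.2], by linarith [ht.1, ht.2]⟩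
    have hcomp := fun w hw => X.ray_components isOpen_Ioo isPreconnected_Ioo h00 hγ (w := w) hw
    rw [h0] at hcomp
    have hd : ∀ w ∈ Ioo (-a) a, HasDerivWithinAt (fun w => ρ (γ w).2.2)
        (dirDeriv ρ (γ w).2.2 (X.rayVec f t₀ (γ w).1 (γ w).2.1 (γ w).2.2)) (Ioo (-a) a) w := by
      intro w hw
      exact (hasDerivAt_comp_curve (hρ.mdifferentiable (by simp) (γ w).2.2)
        (hcomp w hw).2.2).hasDerivWithinAt
    have hle := (convex_Ioo (-a) a).norm_image_sub_le_of_norm_hasDerivWithin_le hd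
      (C := 2 * √‖q.2.1‖) (fun w hw => by
        rw [Real.norm_eq_abs, (hcomp w hw).2.1]
        exact hb _ _ _) h00 ht
    obtain ⟨h1, h2, -⟩ := hcomp t ht
    refine ⟨⟨by linarith [ht.1], by linarith [ht.2]⟩, h2, ?_⟩
    change ρ (γ t).2.2 ≤ ρ q.2.2 + 2 * √‖q.2.1‖ * T
    rw [h0, Real.norm_eq_abs, sub_zero, Real.norm_eq_abs] at hle
    have h3 : |t| ≤ T := (abs_le.mpr ⟨by linarith [ht.1], by linarith [ht.2]⟩)
    have h4 := le_abs_self (ρ (γ t).2.2 - ρ q.2.2)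
    have h5 : 2 * √‖q.2.1‖ * |t| ≤ 2 * √‖q.2.1‖ * T := by gcongr
    linarith

end Rays

section RadialFlow

variable {s n : ℕ} {N : Type*} [TopologicalSpace N]
  [ChartedSpace (EuclideanSpace ℝ (Fin n)) N] [IsManifold (𝓡 n) ∞ N] {t₀ : Time s}

/-- The flow follows `X`, cut off by `f`, along the rays `v ↦ t₀ + v² u`. -/
def GenFlow.IsRadial (g : GenFlow s n N t₀) (X : PolyField s n N) (f : Time s × N → ℝ) : Prop :=
  ∀ (u : Time s) (x : N) (v : ℝ),
    HasMFDerivAt 𝓘(ℝ, ℝ) (𝓡 n) (fun v : ℝ => g.diffeo (t₀ + v ^ 2 • u) x) v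
      ((1 : ℝ →L[ℝ] ℝ).smulRight (X.rayVec f t₀ v u (g.diffeo (t₀ + v ^ 2 • u) x)))

variable (X : PolyField s n N) {f : Time s × N → ℝ}

lemma PolyField.rayVec_zero (v : ℝ) (y : N) : X.rayVec f t₀ v 0 y = 0 := by
  simp [PolyField.rayVec, PolyField.contract]

lemma PolyField.rayVec_scale (v w : ℝ) (u : Time s) (y : N) :
    v • X.rayVec f t₀ (w * v) u y = X.rayVec f t₀ w (v ^ 2 • u) y := by
  have h : (w * v) ^ 2 • u = w ^ 2 • v ^ 2 • u := by rw [smul_smul, mul_pow]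
  simp only [PolyField.rayVec, PolyField.contract, h, Finset.smul_sum, smul_smul,
    PiLp.smul_apply, smul_eq_mul]
  refine Finset.sum_congr rfl fun π _ => ?_
  congr 1
  ring

variable {Θ : ℝ → RaySpace s N → RaySpace s N}

lemma PolyField.flow_components
    (h0 : ∀ q, Θ 0 q = q)
    (hΘ : ∀ q, IsMIntegralCurve (I := rayModel s n) (fun r => Θ r q) (X.rayField f t₀))
    (w : ℝ) (q : RaySpace s N) :
    (Θ w q).1 = q.1 + w ∧ (Θ w q).2.1 = q.2.1 ∧
      HasMFDerivAt 𝓘(ℝ, ℝ) (𝓡 n) (fun w => (Θ w q).2.2) w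
        ((1 : ℝ →L[ℝ] ℝ).smulRight (X.rayVec f t₀ (q.1 + w) q.2.1 (Θ w q).2.2)) := by
  obtain ⟨h1, h2, h3⟩ := X.ray_components isOpen_univ isPreconnected_univ (mem_univ _)
    ((hΘ q).isMIntegralCurveOn univ) (mem_univ w)
  rw [h0] at h1 h2
  rw [h1, h2] at h3
  exact ⟨h1, h2, h3⟩

lemma PolyField.eq_flow [T2Space N] (hf : ContMDiff ((𝓡 s).prod (𝓡 n)) 𝓘(ℝ, ℝ) ∞ f)
    (h0 : ∀ q, Θ 0 q = q)
    (hΘ : ∀ q, IsMIntegralCurve (I := rayModel s n) (fun r => Θ r q) (X.rayField f t₀))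
    {u : Time s} {y : ℝ → N}
    (hy : ∀ w, HasMFDerivAt 𝓘(ℝ, ℝ) (𝓡 n) y w
      ((1 : ℝ →L[ℝ] ℝ).smulRight (X.rayVec f t₀ w u (y w)))) (w : ℝ) :
    (Θ w (0, (u, y 0))).2.2 = y w := by
  have hV1 : ContMDiff (rayModel s n) (rayModel s n).tangent 1 (fun q : RaySpace s N =>
      (⟨q, X.rayField f t₀ q⟩ : TangentBundle (rayModel s n) (RaySpace s N))) :=
    (X.contMDiff_rayField hf).of_le (by simp)
  have h1 : IsManifold (rayModel s n) 1 (RaySpace s N) := IsManifold.of_le (n := ∞) (by simp)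
  have hβ : IsMIntegralCurve (I := rayModel s n)
      (fun w => ((w + 0, (u, y w)) : RaySpace s N)) (X.rayField f t₀) := fun w =>
    X.hasMFDerivAt_rayField (by rw [add_zero]; exact hy w)
  have := isMIntegralCurve_Ioo_eq_of_contMDiff_boundaryless (t₀ := 0) hV1
    (hΘ (0, (u, y 0))) hβ (by simp [h0])
  exact congrArg (fun q : RaySpace s N => q.2.2) (congrFun this w)

/-- The generalised flow obtained by following the rays `v ↦ t₀ + v² u` for `0 ≤ v ≤ 1`. -/
theorem PolyField.exists_isRadial [T2Space N] (hf : ContMDiff ((𝓡 s).prod (𝓡 n)) 𝓘(ℝ, ℝ) ∞ f)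
    (hex : ∀ q, ∃ γ : ℝ → RaySpace s N, γ 0 = q ∧
      IsMIntegralCurve (I := rayModel s n) γ (X.rayField f t₀)) :
    ∃ g : GenFlow s n N t₀, g.IsRadial X f := by
  choose γ hγ0 hγ using hex
  obtain ⟨Θ, hΘdef⟩ : ∃ Θ : ℝ → RaySpace s N → RaySpace s N, Θ = fun r q => γ q r := ⟨_, rfl⟩
  have h0 : ∀ q, Θ 0 q = q := by rw [hΘdef]; exact hγ0
  have hΘ : ∀ q, IsMIntegralCurve (I := rayModel s n) (fun r => Θ r q) (X.rayField f t₀) := by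
    rw [hΘdef]; exact hγ
  have hV := X.contMDiff_rayField (t₀ := t₀) hf
  have hV1 : ContMDiff (rayModel s n) (rayModel s n).tangent 1 (fun q : RaySpace s N =>
      (⟨q, X.rayField f t₀ q⟩ : TangentBundle (rayModel s n) (RaySpace s N))) :=
    hV.of_le (by simp)
  have h1 : IsManifold (rayModel s n) 1 (RaySpace s N) := IsManifold.of_le (n := ∞) (by simp)
  have hadd := flow_add hV1 h0 hΘ
  have hsm : ContMDiff (𝓘(ℝ, ℝ).prod (rayModel s n)) (rayModel s n) ∞
      (fun p : ℝ × RaySpace s N => Θ p.1 p.2) := contMDiff_flow hV Θ h0 hΘ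
  have hslice : ∀ r c : ℝ, ContMDiff ((𝓡 s).prod (𝓡 n)) (𝓡 n) ∞
      (fun p : Time s × N => (Θ r (c, (p.1 - t₀, p.2))).2.2) := fun r c => by
    have h2 : ContMDiff ((𝓡 s).prod (𝓡 n)) (𝓡 s) ∞ (fun p : Time s × N => p.1 - t₀) :=
      (contDiff_id.sub contDiff_const).contMDiff.comp contMDiff_fst
    have h3 : ContMDiff ((𝓡 s).prod (𝓡 n)) (𝓘(ℝ, ℝ).prod (rayModel s n)) ∞
        (fun p : Time s × N => ((r, (c, (p.1 - t₀, p.2))) : ℝ × RaySpace s N)) :=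
      contMDiff_const.prodMk (contMDiff_const.prodMk (h2.prodMk contMDiff_snd))
    exact (contMDiff_snd.comp contMDiff_snd).comp (hsm.comp h3)
  have hpt : ∀ (r c : ℝ) (u : Time s) (x : N),
      Θ r (c, (u, x)) = (c + r, (u, (Θ r (c, (u, x))).2.2)) := fun r c u x => by
    obtain ⟨h2, h3, -⟩ := X.flow_components h0 hΘ r (c, (u, x))
    exact Prod.ext h2 (Prod.ext h3 rfl)
  have hinv : ∀ (r c : ℝ) (u : Time s) (x : N),
      (Θ (-r) (c + r, (u, (Θ r (c, (u, x))).2.2))).2.2 = x := fun r c u x => by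
    rw [← hpt, ← hadd, neg_add_cancel, h0]
  let g : GenFlow s n N t₀ :=
    { diffeo := fun t =>
        { toFun := fun x => (Θ 1 (0, (t - t₀, x))).2.2
          invFun := fun y => (Θ (-1) (1, (t - t₀, y))).2.2
          left_inv := fun x => by simpa using hinv 1 0 (t - t₀) x
          right_inv := fun x => by simpa using hinv (-1) 1 (t - t₀) x
          contMDiff_toFun := (hslice 1 0).comp (contMDiff_const.prodMk contMDiff_id)
          contMDiff_invFun := (hslice (-1) 1).comp (contMDiff_const.prodMk contMDiff_id) }
      smooth := hslice 1 0
      smooth_symm := hslice (-1) 1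
      foot := by
        refine Diffeomorph.ext fun x => ?_
        have h2 := X.eq_flow (u := (0 : Time s)) (y := fun _ => x) hf h0 hΘ (fun w => by
          rw [X.rayVec_zero]
          have := hasMFDerivAt_const (I := 𝓘(ℝ, ℝ)) (I' := 𝓡 n) x w
          refine (congrArg (HasMFDerivAt 𝓘(ℝ, ℝ) (𝓡 n) (fun _ : ℝ => x) w) ?_).mp this
          exact ContinuousLinearMap.ext fun a : ℝ => (smul_zero a).symm) 1
        change (Θ 1 (0, (t₀ - t₀, x))).2.2 = x
        rw [sub_self]
        exact h2 }
  have hg : ∀ t x, g.diffeo t x = (Θ 1 (0, (t - t₀, x))).2.2 := fun _ _ => rfl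
  refine ⟨g, fun u x v => ?_⟩
  have hy := fun w => (X.flow_components h0 hΘ w (0, (u, x))).2.2
  simp only [zero_add] at hy
  have hhom : ∀ v : ℝ, g.diffeo (t₀ + v ^ 2 • u) x = (Θ v (0, (u, x))).2.2 := fun v => by
    have h2 := X.eq_flow (u := v ^ 2 • u) (y := fun w => (Θ (w * v) (0, (u, x))).2.2) hf h0 hΘ
      (fun w => by
        have h3 : HasMFDerivAt 𝓘(ℝ, ℝ) 𝓘(ℝ, ℝ) (fun w : ℝ => w * v) w
          ((1 : ℝ →L[ℝ] ℝ).smulRight v) :=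
          (hasDerivAt_mul_const v).hasFDerivAt.hasMFDerivAt
        have h4 := HasMFDerivAt.comp w (hy (w * v)) h3
        refine (congrArg (HasMFDerivAt 𝓘(ℝ, ℝ) (𝓡 n) _ w) ?_).mp h4
        rw [← X.rayVec_scale]
        exact ContinuousLinearMap.ext fun a : ℝ => mul_smul a v _) 1
    simp only [zero_mul, one_mul, h0] at h2
    rw [hg, add_sub_cancel_left]
    exact h2
  rw [hhom v]
  exact (hy v).congr_of_eventuallyEq (Filter.Eventually.of_forall hhom)

lemma GenFlow.mfderiv_slice_apply (g : GenFlow s n N t₀) (t u : Time s) (x : N) :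
    mfderiv (𝓡 s) (𝓡 n) (fun τ : Time s => g.diffeo τ x) t u =
      g.field.contract t u (g.diffeo t x) := by
  have hu : u = ∑ π, u π • (dirT π : Time s) := by
    ext π
    simp [Finset.sum_apply, Pi.single_apply]
  refine (congrArg (mfderiv (𝓡 s) (𝓡 n) (fun τ : Time s => g.diffeo τ x) t) hu).trans ?_
  refine (map_sum (mfderiv (𝓡 s) (𝓡 n) (fun τ : Time s => g.diffeo τ x) t) _ _).trans
    (Finset.sum_congr rfl fun π _ => ?_)
  refine (ContinuousLinearMap.map_smul (mfderiv (𝓡 s) (𝓡 n) (fun τ : Time s => g.diffeo τ x) t)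
    (u π) _).trans ?_
  exact congrArg (u π • ·) (g.field_vec_apply π t x).symm

lemma GenFlow.hasMFDerivAt_ray (g : GenFlow s n N t₀) (u : Time s) (x : N) (v : ℝ) :
    HasMFDerivAt 𝓘(ℝ, ℝ) (𝓡 n) (fun v : ℝ => g.diffeo (t₀ + v ^ 2 • u) x) v
      ((1 : ℝ →L[ℝ] ℝ).smulRight ((2 * v) •
        g.field.contract (t₀ + v ^ 2 • u) u (g.diffeo (t₀ + v ^ 2 • u) x))) := by
  have h1 : HasDerivAt (fun v : ℝ => t₀ + v ^ 2 • u) ((2 * v) • u) v := by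
    simpa using ((hasDerivAt_pow 2 v).smul_const u).const_add t₀
  have h2 := HasMFDerivAt.comp v
    (g.hasMFDerivAt_slice (t₀ + v ^ 2 • u) x).mdifferentiableAt.hasMFDerivAt
    h1.hasFDerivAt.hasMFDerivAt
  refine (congrArg (HasMFDerivAt 𝓘(ℝ, ℝ) (𝓡 n) _ v) ?_).mp h2
  refine ContinuousLinearMap.ext fun a : ℝ => ?_
  refine (ContinuousLinearMap.map_smul (mfderiv (𝓡 s) (𝓡 n) (fun τ : Time s => g.diffeo τ x)
    (t₀ + v ^ 2 • u)) a ((2 * v) • u)).trans (congrArg (a • ·) ?_)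
  refine (ContinuousLinearMap.map_smul (mfderiv (𝓡 s) (𝓡 n) (fun τ : Time s => g.diffeo τ x)
    (t₀ + v ^ 2 • u)) (2 * v) u).trans (congrArg ((2 * v) • ·) ?_)
  exact g.mfderiv_slice_apply _ _ _

/-- Every flow is radial for the polyvector field it generates. -/
lemma GenFlow.isRadial_field (g : GenFlow s n N t₀) : g.IsRadial g.field (fun _ => 1) := by
  intro u x v
  simpa only [PolyField.rayVec, mul_one] using g.hasMFDerivAt_ray u x v

lemma GenFlow.IsRadial.contract_field {g : GenFlow s n N t₀} (hg : g.IsRadial X f) (t : Time s)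
    (x : N) :
    g.field.contract t (t - t₀) (g.diffeo t x) =
      f (t, g.diffeo t x) • X.contract t (t - t₀) (g.diffeo t x) := by
  have key : ∀ u τ : Time s, τ = t₀ + (1 : ℝ) ^ 2 • u →
      g.field.contract τ u (g.diffeo τ x) =
        f (τ, g.diffeo τ x) • X.contract τ u (g.diffeo τ x) := by
    rintro u _ rfl
    have h1 := hasMFDerivAt_unique (g.hasMFDerivAt_ray u x 1) (hg u x 1)
    have h2 := DFunLike.congr_fun h1 (1 : ℝ)
    replace h2 := ((one_smul ℝ _).symm.trans h2).trans (one_smul ℝ _)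
    rw [PolyField.rayVec, mul_smul (2 * (1 : ℝ)) (f _)] at h2
    exact smul_right_injective _ (by norm_num : (2 * (1 : ℝ)) ≠ 0) h2
  exact key (t - t₀) t (by simp)

end RadialFlow

section Uniqueness

variable {s n : ℕ} {N : Type*} [TopologicalSpace N]
  [ChartedSpace (EuclideanSpace ℝ (Fin n)) N] [IsManifold (𝓡 n) ∞ N] {t₀ : Time s}

/-- The germ of a flow is determined by the germ of the field that it generates. -/
lemma GenFlow.flow_germ_eq [T2Space N] {g h : GenFlow s n N t₀}
    (hgh : fieldSetoid s n N t₀ ⟨g.field, g.isIntegrable_field⟩ ⟨h.field, h.isIntegrable_field⟩) :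
    flowSetoid s n N t₀ g h := by
  refine eventually_nhdsSet_foot_iff.mpr fun x₀ => ?_
  have h1 : ∀ᶠ p in 𝓝 (t₀, x₀), ∀ π : Fin s, g.field.vec π p.1 p.2 = h.field.vec π p.1 p.2 :=
    eventually_nhdsSet_foot_iff.mp hgh x₀
  let Ψ : (Time s × N) × ℝ → Time s × N := fun z =>
    (t₀ + z.2 ^ 2 • (z.1.1 - t₀), g.diffeo (t₀ + z.2 ^ 2 • (z.1.1 - t₀)) z.1.2)
  have hΨ : Continuous Ψ := by
    have h2 : Continuous (fun z : (Time s × N) × ℝ => t₀ + z.2 ^ 2 • (z.1.1 - t₀)) := by fun_prop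
    exact h2.prodMk (g.smooth.continuous.comp (h2.prodMk (continuous_snd.comp continuous_fst)))
  have h2 : ∀ᶠ p in 𝓝 (t₀, x₀), ∀ v ∈ Icc (-2 : ℝ) 2, ∀ π : Fin s,
      g.field.vec π (Ψ (p, v)).1 (Ψ (p, v)).2 = h.field.vec π (Ψ (p, v)).1 (Ψ (p, v)).2 := by
    refine isCompact_Icc.eventually_forall_of_forall_eventually fun v _ => ?_
    have h3 : Ψ ((t₀, x₀), v) = (t₀, x₀) := by
      simp only [Ψ, sub_self, smul_zero, add_zero, g.diffeo_foot]
    have h4 : Filter.Tendsto Ψ (𝓝 ((t₀, x₀), v)) (𝓝 (t₀, x₀)) := by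
      have := hΨ.tendsto ((t₀, x₀), v)
      rwa [h3] at this
    exact h4.eventually h1
  filter_upwards [h2] with p hp
  have hc : ∀ {k : GenFlow s n N t₀}, k.IsRadial h.field (fun _ => 1) ∨ k = g →
      IsMIntegralCurveOn (I := rayModel s n)
        (fun v => ((v + 0, (p.1 - t₀, k.diffeo (t₀ + v ^ 2 • (p.1 - t₀)) p.2)) : RaySpace s N))
        (h.field.rayField (fun _ => 1) t₀) (Ioo (-2) 2) := by
    intro k hk v hv
    refine HasMFDerivAt.hasMFDerivWithinAt (h.field.hasMFDerivAt_rayField ?_)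
    rw [add_zero]
    rcases hk with hk | rfl
    · exact hk (p.1 - t₀) p.2 v
    · have h3 := k.isRadial_field (p.1 - t₀) p.2 v
      have h4 : k.field.rayVec (fun _ => 1) t₀ v (p.1 - t₀)
          (k.diffeo (t₀ + v ^ 2 • (p.1 - t₀)) p.2) = h.field.rayVec (fun _ => 1) t₀ v (p.1 - t₀)
          (k.diffeo (t₀ + v ^ 2 • (p.1 - t₀)) p.2) := by
        simp only [PolyField.rayVec, PolyField.contract]
        congr 1
        exact Finset.sum_congr rfl fun π _ => congrArg _ (hp v (Ioo_subset_Icc_self hv) π)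
      rw [h4] at h3
      exact h3
  have hV1 : ContMDiff (rayModel s n) (rayModel s n).tangent 1 (fun q : RaySpace s N =>
      (⟨q, h.field.rayField (fun _ => 1) t₀ q⟩ : TangentBundle (rayModel s n) (RaySpace s N))) :=
    (h.field.contMDiff_rayField contMDiff_const).of_le (by simp)
  have hM : IsManifold (rayModel s n) 1 (RaySpace s N) := IsManifold.of_le (n := ∞) (by simp)
  have h3 := isMIntegralCurveOn_Ioo_eqOn_of_contMDiff_boundaryless (t₀ := 0) (by norm_num) hV1
    (hc (k := g) (Or.inr rfl)) (hc (k := h) (Or.inl h.isRadial_field)) (by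
      simp [g.diffeo_foot, h.diffeo_foot]) (show (1 : ℝ) ∈ Ioo (-2 : ℝ) 2 by norm_num)
  have h4 := congrArg (fun q : RaySpace s N => q.2.2) h3
  simpa using h4

end Uniqueness

section Frobenius

variable {T E : Type*} [NormedAddCommGroup T] [NormedSpace ℝ T] [NormedAddCommGroup E]
  [NormedSpace ℝ E] {F : T × E → T →L[ℝ] E} {U : Set (T × E)} {γ : T → E} {t₀ : T} {δ : ℝ}

/-- The derivative of the defect `F (t, γ t) - γ' t` of a solution which is radial. -/
lemma fderiv_defect_radial (hU : IsOpen U) (hF : ContDiffOn ℝ 1 F U)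
    (hsymm : ∀ p ∈ U, ∀ a b, fderiv ℝ F p (a, F p a) b = fderiv ℝ F p (b, F p b) a)
    (hγ : ContDiffOn ℝ 2 γ (Metric.ball t₀ δ)) (hγU : ∀ t ∈ Metric.ball t₀ δ, (t, γ t) ∈ U)
    (hrad : ∀ t ∈ Metric.ball t₀ δ, fderiv ℝ γ t (t - t₀) = F (t, γ t) (t - t₀))
    {t : T} (ht : t ∈ Metric.ball t₀ δ) (a : T) :
    DifferentiableAt ℝ (fun t => F (t, γ t) - fderiv ℝ γ t) t ∧
      fderiv ℝ (fun t => F (t, γ t) - fderiv ℝ γ t) t (t - t₀) a + (F (t, γ t) a - fderiv ℝ γ t a) =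
        fderiv ℝ F (t, γ t) (0, F (t, γ t) a - fderiv ℝ γ t a) (t - t₀) := by
  have hB : Metric.ball t₀ δ ∈ 𝓝 t := Metric.isOpen_ball.mem_nhds ht
  have hγt : ContDiffAt ℝ 2 γ t := hγ.contDiffAt hB
  have hγd : HasFDerivAt γ (fderiv ℝ γ t) t := (hγt.differentiableAt (by simp)).hasFDerivAt
  have hγ2 : HasFDerivAt (fderiv ℝ γ) (fderiv ℝ (fderiv ℝ γ) t) t :=
    ((hγt.fderiv_right (m := 1) (by norm_num)).differentiableAt (by simp)).hasFDerivAt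
  have hFd : HasFDerivAt F (fderiv ℝ F (t, γ t)) (t, γ t) :=
    ((hF.contDiffAt (hU.mem_nhds (hγU t ht))).differentiableAt (by simp)).hasFDerivAt
  have hFγ : HasFDerivAt (fun t => F (t, γ t))
      ((fderiv ℝ F (t, γ t)).comp ((ContinuousLinearMap.id ℝ T).prod (fderiv ℝ γ t))) t :=
    HasFDerivAt.comp t (f := fun t => (t, γ t)) hFd ((hasFDerivAt_id t).prodMk hγd)
  have hR : HasFDerivAt (fun t => F (t, γ t) - fderiv ℝ γ t) _ t := hFγ.sub hγ2
  have hsub : HasFDerivAt (fun t => t - t₀) (ContinuousLinearMap.id ℝ T) t :=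
    (hasFDerivAt_id t).sub_const t₀
  have hz : HasFDerivAt (fun t => (F (t, γ t) - fderiv ℝ γ t) (t - t₀)) (0 : T →L[ℝ] E) t := by
    refine (hasFDerivAt_const (0 : E) t).congr_of_eventuallyEq ?_
    filter_upwards [hB] with t ht
    rw [sub_apply, hrad t ht, sub_self]
  have h1 := DFunLike.congr_fun (hz.unique (hR.clm_apply hsub)) a
  have hR0 : F (t, γ t) (t - t₀) - fderiv ℝ γ t (t - t₀) = 0 := by rw [hrad t ht, sub_self]
  have hsnd : fderiv ℝ (fderiv ℝ γ) t a (t - t₀) = fderiv ℝ (fderiv ℝ γ) t (t - t₀) a :=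
    hγt.isSymmSndFDerivAt (by simp) a (t - t₀)
  refine ⟨hR.differentiableAt, ?_⟩
  have e := hsymm (t, γ t) (hγU t ht) a (t - t₀)
  have e1 : ((a, fderiv ℝ γ t a) : T × E) =
      (a, F (t, γ t) a) - (0, F (t, γ t) a - fderiv ℝ γ t a) := by simp
  rw [HasFDerivAt.fderiv hR]
  simp only [zero_apply, add_apply,
    ContinuousLinearMap.comp_apply, ContinuousLinearMap.flip_apply, sub_apply,
    ContinuousLinearMap.prod_apply, ContinuousLinearMap.id_apply, hrad t ht] at h1 ⊢
  rw [e1, map_sub (fderiv ℝ F (t, γ t)), sub_apply, e, hsnd] at h1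
  rw [← sub_eq_zero]
  rw [eq_comm] at h1
  rw [← h1]
  abel

/-- A Frobenius type theorem: for a total differential equation satisfying the integrability
condition, radial solutions are solutions. -/
theorem fderiv_eq_of_radial (hU : IsOpen U) (hF : ContDiffOn ℝ 1 F U)
    (hsymm : ∀ p ∈ U, ∀ a b, fderiv ℝ F p (a, F p a) b = fderiv ℝ F p (b, F p b) a)
    (hγ : ContDiffOn ℝ 2 γ (Metric.ball t₀ δ)) (hγU : ∀ t ∈ Metric.ball t₀ δ, (t, γ t) ∈ U)
    (hrad : ∀ t ∈ Metric.ball t₀ δ, fderiv ℝ γ t (t - t₀) = F (t, γ t) (t - t₀))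
    {t : T} (ht : t ∈ Metric.ball t₀ δ) : fderiv ℝ γ t = F (t, γ t) := by
  ext a
  set u := t - t₀ with hu
  have hmem : ∀ r ∈ Icc (0 : ℝ) 1, t₀ + r • u ∈ Metric.ball t₀ δ := fun r hr => by
    rw [Metric.mem_ball, dist_eq_norm, add_sub_cancel_left, norm_smul, Real.norm_eq_abs,
      abs_of_nonneg hr.1]
    rw [Metric.mem_ball, dist_eq_norm] at ht
    exact (mul_le_of_le_one_left (norm_nonneg _) hr.2).trans_lt ht
  let R : T → T →L[ℝ] E := fun t => F (t, γ t) - fderiv ℝ γ t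
  let k : ℝ → E := fun r => r • R (t₀ + r • u) a
  have hray : ∀ r : ℝ, HasDerivAt (fun r : ℝ => t₀ + r • u) u r := fun r => by
    simpa using ((hasDerivAt_id r).smul_const u).const_add t₀
  have hk : ∀ r ∈ Icc (0 : ℝ) 1, HasDerivAt k
      (fderiv ℝ F (t₀ + r • u, γ (t₀ + r • u)) (0, k r) u) r := fun r hr => by
    obtain ⟨h1, h2⟩ := fderiv_defect_radial hU hF hsymm hγ hγU hrad (hmem r hr) a
    have h3 : HasDerivAt (fun r : ℝ => R (t₀ + r • u)) (fderiv ℝ R (t₀ + r • u) u) r :=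
      HasFDerivAt.comp_hasDerivAt r (l := R) h1.hasFDerivAt (hray r)
    have h4 : HasDerivAt (fun r : ℝ => R (t₀ + r • u) a) (fderiv ℝ R (t₀ + r • u) u a) r := by
      simpa using h3.clm_apply (hasDerivAt_const r a)
    have h5 := (hasDerivAt_id r).smul h4
    refine h5.congr_deriv ?_
    rw [add_sub_cancel_left, map_smul, smul_apply, map_smul] at h2
    change r • fderiv ℝ R (t₀ + r • u) u a + (1 : ℝ) • R (t₀ + r • u) a = _
    rw [one_smul]
    refine h2.trans ?_
    have e : ((0, k r) : T × E) = r • (0, R (t₀ + r • u) a) := by simp [k]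
    rw [e, map_smul]
    rfl
  have hcont : ContinuousOn (fun r : ℝ => fderiv ℝ F (t₀ + r • u, γ (t₀ + r • u))) (Icc 0 1) := by
    have h1 : ContinuousOn (fderiv ℝ F) U := hF.continuousOn_fderiv_of_isOpen hU le_rfl
    have h2 : ContinuousOn (fun r : ℝ => t₀ + r • u) (Icc 0 1) := by fun_prop
    exact h1.comp (h2.prodMk (hγ.continuousOn.comp h2 hmem)) fun r hr => hγU _ (hmem r hr)
  obtain ⟨C, hC⟩ := (isCompact_Icc.image_of_continuousOn
    (ContinuousOn.norm (E := T × E →L[ℝ] T →L[ℝ] E) hcont)).bddAbove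
  have hzero := eq_zero_of_abs_deriv_le_mul_abs_self_of_eq_zero_right (f := k) (K := C * ‖u‖)
    (a := 0) (b := 1) (fun r hr => (hk r hr).continuousAt.continuousWithinAt)
    (fun r hr => (hk r (Ico_subset_Icc_self hr)).hasDerivWithinAt) (by simp [k])
    (fun r hr => by
      refine (ContinuousLinearMap.le_opNorm _ _).trans ?_
      have h1 := (fderiv ℝ F (t₀ + r • u, γ (t₀ + r • u))).le_opNorm ((0, k r) : T × E)
      have h2 := hC ⟨r, Ico_subset_Icc_self hr, rfl⟩
      have h3 : ‖((0, k r) : T × E)‖ = ‖k r‖ := by simp [Prod.norm_def]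
      rw [h3] at h1
      change ‖fderiv ℝ F (t₀ + r • u, γ (t₀ + r • u))‖ ≤ C at h2
      calc _ ≤ ‖fderiv ℝ F (t₀ + r • u, γ (t₀ + r • u))‖ * ‖k r‖ * ‖u‖ := by gcongr
        _ ≤ C * ‖k r‖ * ‖u‖ := by gcongr
        _ = C * ‖u‖ * ‖k r‖ := by ring) 1 (by simp)
  simp only [k, one_smul, hu, add_sub_cancel, R, sub_apply] at hzero
  exact (sub_eq_zero.mp hzero).symm

end Frobenius

section ChartForm

variable {s n : ℕ} {N : Type*} [TopologicalSpace N]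
  [ChartedSpace (EuclideanSpace ℝ (Fin n)) N] [IsManifold (𝓡 n) ∞ N] {t₀ : Time s}
  (X : PolyField s n N) (x₀ : N)

/-- The expression of `X_π` in the preferred chart at `x₀`. -/
def PolyField.chartVec (π : Fin s) (p : Time s × EuclideanSpace ℝ (Fin n)) :
    EuclideanSpace ℝ (Fin n) :=
  chartField (𝓡 n) (X.vec π p.1) x₀ p.2

/-- The expression of `X` in the preferred chart at `x₀`, as a family of linear maps on `ℝ^s`. -/
def PolyField.chartForm (p : Time s × EuclideanSpace ℝ (Fin n)) :
    Time s →L[ℝ] EuclideanSpace ℝ (Fin n) :=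
  ∑ π, (EuclideanSpace.proj (𝕜 := ℝ) π : Time s →L[ℝ] ℝ).smulRight (X.chartVec x₀ π p)

omit [IsManifold (𝓡 n) ∞ N] in
variable (s) in
lemma isOpen_chartDomain :
    IsOpen ((univ : Set (Time s)) ×ˢ (extChartAt (𝓡 n) x₀).target) :=
  isOpen_univ.prod (isOpen_extChartAt_target x₀)

omit [IsManifold (𝓡 n) ∞ N] in
lemma mem_prod_target (t₀ : Time s) {p : Time s × EuclideanSpace ℝ (Fin n)}
    (hp : p ∈ (univ : Set (Time s)) ×ˢ (extChartAt (𝓡 n) x₀).target) :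
    p ∈ (extChartAt ((𝓡 s).prod (𝓡 n)) (t₀, x₀)).target := by
  rw [extChartAt_prod, extChartAt_model_space_eq_id]
  exact ⟨mem_univ _, hp.2⟩

lemma PolyField.chartForm_apply (p : Time s × EuclideanSpace ℝ (Fin n)) (u : Time s) :
    X.chartForm x₀ p u = ∑ π, u π • X.chartVec x₀ π p := by
  simp [PolyField.chartForm]

lemma PolyField.contDiffOn_chartVec (π : Fin s) :
    ContDiffOn ℝ ∞ (X.chartVec x₀ π)
      ((univ : Set (Time s)) ×ˢ (extChartAt (𝓡 n) x₀).target) := by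
  have h1 := contDiffOn_chartField (X.contMDiff_auton π) ((0 : Time s), x₀)
  have h2 : ContDiffOn ℝ ∞ (fun p => (chartField ((𝓡 s).prod (𝓡 n)) (X.auton π)
      ((0 : Time s), x₀) p).2) ((univ : Set (Time s)) ×ˢ (extChartAt (𝓡 n) x₀).target) :=
    contDiff_snd.comp_contDiffOn (h1.mono fun p hp => mem_prod_target x₀ 0 hp)
  refine h2.congr fun p hp => ?_
  exact (congrArg Prod.snd (X.chartField_auton π ((0 : Time s), x₀) p.1 hp.2)).symm

lemma PolyField.contDiffOn_chartForm :
    ContDiffOn ℝ ∞ (X.chartForm x₀)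
      ((univ : Set (Time s)) ×ˢ (extChartAt (𝓡 n) x₀).target) := by
  refine ContDiffOn.sum fun π _ => ?_
  exact contDiffOn_const.smulRight (X.contDiffOn_chartVec x₀ π)

lemma PolyField.hasFDerivAt_chartVec (π : Fin s) {p : Time s × EuclideanSpace ℝ (Fin n)}
    (hp : p ∈ (univ : Set (Time s)) ×ˢ (extChartAt (𝓡 n) x₀).target) :
    HasFDerivAt (X.chartVec x₀ π) (fderiv ℝ (X.chartVec x₀ π) p) p :=
  (((X.contDiffOn_chartVec x₀ π).contDiffAt
    ((isOpen_chartDomain s x₀).mem_nhds hp)).differentiableAt (by simp)).hasFDerivAt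

/-- The zero curvature condition in a chart. -/
lemma PolyField.IsIntegrable.fderiv_chartVec (hX : X.IsIntegrable) (π ν : Fin s)
    {p : Time s × EuclideanSpace ℝ (Fin n)}
    (hp : p ∈ (univ : Set (Time s)) ×ˢ (extChartAt (𝓡 n) x₀).target) :
    fderiv ℝ (X.chartVec x₀ ν) p (dirT π, X.chartVec x₀ π p) =
      fderiv ℝ (X.chartVec x₀ π) p (dirT ν, X.chartVec x₀ ν p) := by
  have hp' := mem_prod_target x₀ (0 : Time s) hp
  have h := chartField_mlieBracket (X.contMDiff_auton π) (X.contMDiff_auton ν)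
    ((0 : Time s), x₀) hp'
  have h0 : chartField ((𝓡 s).prod (𝓡 n)) (mlieBracket ((𝓡 s).prod (𝓡 n)) (X.auton π)
      (X.auton ν)) ((0 : Time s), x₀) p = 0 := by
    have h1 : mlieBracket ((𝓡 s).prod (𝓡 n)) (X.auton π) (X.auton ν) = 0 := funext (hX π ν)
    rw [chartField, h1, mpullbackWithin_zero]
    rfl
  have hev : ∀ μ : Fin s, chartField ((𝓡 s).prod (𝓡 n)) (X.auton μ) ((0 : Time s), x₀) =ᶠ[𝓝 p]
      fun q => ((dirT μ, X.chartVec x₀ μ q) : Time s × EuclideanSpace ℝ (Fin n)) := by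
    intro μ
    filter_upwards [(isOpen_chartDomain s x₀).mem_nhds hp] with q hq
    exact X.chartField_auton μ ((0 : Time s), x₀) q.1 hq.2
  have hd : ∀ μ : Fin s, fderiv ℝ
      (fun q => ((dirT μ, X.chartVec x₀ μ q) : Time s × EuclideanSpace ℝ (Fin n))) p =
      (0 : Time s × EuclideanSpace ℝ (Fin n) →L[ℝ] Time s).prod
        (fderiv ℝ (X.chartVec x₀ μ) p) := fun μ =>
    ((hasFDerivAt_const (dirT μ : Time s) p).prodMk (X.hasFDerivAt_chartVec x₀ μ hp)).fderiv
  rw [h0, (hev π).lieBracket_vectorField_eq (hev ν), lieBracket, hd, hd] at h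
  exact (sub_eq_zero.mp (congrArg Prod.snd h).symm)

lemma PolyField.IsIntegrable.fderiv_chartForm (hX : X.IsIntegrable)
    {p : Time s × EuclideanSpace ℝ (Fin n)}
    (hp : p ∈ (univ : Set (Time s)) ×ˢ (extChartAt (𝓡 n) x₀).target) (a b : Time s) :
    fderiv ℝ (X.chartForm x₀) p (a, X.chartForm x₀ p a) b =
      fderiv ℝ (X.chartForm x₀) p (b, X.chartForm x₀ p b) a := by
  have hd : ∀ w b, fderiv ℝ (X.chartForm x₀) p w b =
      ∑ π, b π • fderiv ℝ (X.chartVec x₀ π) p w := fun w b => by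
    have h1 : HasFDerivAt (X.chartForm x₀) (fderiv ℝ (X.chartForm x₀) p) p :=
      (((X.contDiffOn_chartForm x₀).contDiffAt
        ((isOpen_chartDomain s x₀).mem_nhds hp)).differentiableAt (by simp)).hasFDerivAt
    have h2 : HasFDerivAt (fun q => X.chartForm x₀ q b)
        (∑ π, b π • fderiv ℝ (X.chartVec x₀ π) p) p := by
      simp only [X.chartForm_apply]
      exact HasFDerivAt.fun_sum fun π _ => (X.hasFDerivAt_chartVec x₀ π hp).const_smul (b π)
    have h3 := (h1.clm_apply (hasFDerivAt_const b p)).unique h2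
    simpa using DFunLike.congr_fun h3 w
  have hsum : ∀ a : Time s, ((a, X.chartForm x₀ p a) : Time s × EuclideanSpace ℝ (Fin n)) =
      ∑ π, a π • ((dirT π, X.chartVec x₀ π p) : Time s × EuclideanSpace ℝ (Fin n)) := fun a => by
    refine Prod.ext ?_ ?_
    · rw [Prod.fst_sum]
      ext π
      simp [Finset.sum_apply, Pi.single_apply]
    · rw [Prod.snd_sum]
      exact X.chartForm_apply x₀ p a
  simp only [hsum, map_sum, map_smul, sum_apply, smul_apply, hd,
    Finset.smul_sum]
  rw [Finset.sum_comm]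
  refine Finset.sum_congr rfl fun π _ => Finset.sum_congr rfl fun ν _ => ?_
  rw [smul_comm, hX.fderiv_chartVec X x₀ π ν hp]

lemma PolyField.mfderiv_symm_chartForm {t : Time s} {z : EuclideanSpace ℝ (Fin n)}
    (hz : z ∈ (extChartAt (𝓡 n) x₀).target) (u : Time s) :
    mfderiv 𝓘(ℝ, EuclideanSpace ℝ (Fin n)) (𝓡 n) (extChartAt (𝓡 n) x₀).symm z
      (X.chartForm x₀ (t, z) u) = X.contract t u ((extChartAt (𝓡 n) x₀).symm z) := by
  refine (congrArg (mfderiv 𝓘(ℝ, EuclideanSpace ℝ (Fin n)) (𝓡 n) (extChartAt (𝓡 n) x₀).symm z)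
    (X.chartForm_apply x₀ (t, z) u)).trans ?_
  refine (map_sum (mfderiv 𝓘(ℝ, EuclideanSpace ℝ (Fin n)) (𝓡 n) (extChartAt (𝓡 n) x₀).symm z)
    _ _).trans (Finset.sum_congr rfl fun π _ => ?_)
  refine (ContinuousLinearMap.map_smul (mfderiv 𝓘(ℝ, EuclideanSpace ℝ (Fin n)) (𝓡 n)
    (extChartAt (𝓡 n) x₀).symm z) (u π) _).trans (congrArg (u π • ·) ?_)
  exact mfderiv_symm_chartField x₀ hz

lemma PolyField.contract_dirT (t : Time s) (π : Fin s) (y : N) :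
    X.contract t (dirT π) y = X.vec π t y := by
  simp [PolyField.contract]

end ChartForm

section Surjectivity

variable {s n : ℕ} {N : Type*} [TopologicalSpace N]
  [ChartedSpace (EuclideanSpace ℝ (Fin n)) N] [IsManifold (𝓡 n) ∞ N] {t₀ : Time s}
  {X : PolyField s n N} {f : Time s × N → ℝ}

lemma GenFlow.mfderiv_symm_fderiv_chart (g : GenFlow s n N t₀) (x₀ : N) {t : Time s} {x : N}
    (hx : g.diffeo t x ∈ (extChartAt (𝓡 n) x₀).source) (u : Time s) :
    ContDiffAt ℝ ∞ (fun τ => extChartAt (𝓡 n) x₀ (g.diffeo τ x)) t ∧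
    mfderiv 𝓘(ℝ, EuclideanSpace ℝ (Fin n)) (𝓡 n) (extChartAt (𝓡 n) x₀).symm
      (extChartAt (𝓡 n) x₀ (g.diffeo t x))
      (fderiv ℝ (fun τ => extChartAt (𝓡 n) x₀ (g.diffeo τ x)) t u) =
      g.field.contract t u (g.diffeo t x) := by
  have hsl : ContMDiff (𝓡 s) (𝓡 n) ∞ (fun τ : Time s => g.diffeo τ x) :=
    g.smooth.comp (contMDiff_id.prodMk contMDiff_const)
  have hc : ContDiffAt ℝ ∞ (fun τ => extChartAt (𝓡 n) x₀ (g.diffeo τ x)) t := by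
    refine ContMDiffAt.contDiffAt ?_
    exact ContMDiffAt.comp t (contMDiffAt_extChartAt' (by rwa [extChartAt_source] at hx))
      hsl.contMDiffAt
  refine ⟨hc, ?_⟩
  have h1 := HasMFDerivAt.comp t
    (hasMFDerivAt_extChartAt_symm (I := 𝓡 n) x₀ ((extChartAt (𝓡 n) x₀).map_source hx))
    (hc.differentiableAt (by simp)).hasFDerivAt.hasMFDerivAt
  have h2 : (fun τ : Time s => g.diffeo τ x) =ᶠ[𝓝 t] (extChartAt (𝓡 n) x₀).symm ∘
      (fun τ => extChartAt (𝓡 n) x₀ (g.diffeo τ x)) := by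
    filter_upwards [hsl.continuous.continuousAt.preimage_mem_nhds
      ((isOpen_extChartAt_source (I := 𝓡 n) x₀).mem_nhds hx)] with τ hτ
    exact ((extChartAt (𝓡 n) x₀).left_inv hτ).symm
  have h3 := (h1.congr_of_eventuallyEq h2).mfderiv
  exact (DFunLike.congr_fun h3 u).symm.trans (g.mfderiv_slice_apply t u x)

/-- A flow which is radial for an integrable polyvector field generates the germ of that field. -/
theorem GenFlow.IsRadial.eventually_field_eq {g : GenFlow s n N t₀} (hg : g.IsRadial X f)
    (hX : X.IsIntegrable) (hf : ∀ x : N, ∀ᶠ p in 𝓝 (t₀, x), f p = 1) (x₀ : N) :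
    ∀ᶠ p in 𝓝 (t₀, x₀), ∀ π, g.field.vec π p.1 p.2 = X.vec π p.1 p.2 := by
  have htoFun : Filter.Tendsto g.toFun (𝓝 (t₀, x₀)) (𝓝 (t₀, x₀)) := by
    have h := g.contMDiff_toFun.continuous.tendsto (t₀, x₀)
    have e : g.toFun (t₀, x₀) = (t₀, x₀) := Prod.ext rfl (g.diffeo_foot x₀)
    rwa [e] at h
  have hinvFun : Filter.Tendsto g.invFun (𝓝 (t₀, x₀)) (𝓝 (t₀, x₀)) := by
    have h := g.contMDiff_invFun.continuous.tendsto (t₀, x₀)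
    rwa [g.invFun_foot] at h
  have hsrc : ∀ᶠ p : Time s × N in 𝓝 (t₀, x₀), p.2 ∈ (extChartAt (𝓡 n) x₀).source :=
    continuousAt_snd.eventually (extChartAt_source_mem_nhds (I := 𝓡 n) x₀)
  have hev := htoFun.eventually (hsrc.and (hf x₀))
  rw [nhds_prod_eq] at hev
  obtain ⟨P, hP, Q, hQ, hPQ⟩ := Filter.eventually_prod_iff.mp hev
  obtain ⟨δ, hδ, hball⟩ := Metric.eventually_nhds_iff_ball.mp hP
  have hpush : ∀ᶠ p : Time s × N in 𝓝 (t₀, x₀), ∀ π,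
      g.field.vec π p.1 (g.diffeo p.1 p.2) = X.vec π p.1 (g.diffeo p.1 p.2) := by
    rw [nhds_prod_eq]
    refine Filter.eventually_prod_iff.mpr ⟨_, Metric.ball_mem_nhds t₀ hδ, Q, hQ, ?_⟩
    intro t ht x hx π
    have hgood : ∀ τ ∈ Metric.ball t₀ δ, g.diffeo τ x ∈ (extChartAt (𝓡 n) x₀).source ∧
        f (τ, g.diffeo τ x) = 1 := fun τ hτ => hPQ (hball τ hτ) hx
    have hinj : ∀ τ ∈ Metric.ball t₀ δ, Function.Injective (mfderiv 𝓘(ℝ, EuclideanSpace ℝ (Fin n))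
        (𝓡 n) (extChartAt (𝓡 n) x₀).symm (extChartAt (𝓡 n) x₀ (g.diffeo τ x))) := fun τ hτ => by
      obtain ⟨A, hA⟩ := isInvertible_mfderiv_extChartAt_symm (I := 𝓡 n) x₀
        ((extChartAt (𝓡 n) x₀).map_source (hgood τ hτ).1)
      rw [← hA]
      exact A.injective
    have hform : ∀ τ ∈ Metric.ball t₀ δ, ∀ u : Time s,
        mfderiv 𝓘(ℝ, EuclideanSpace ℝ (Fin n)) (𝓡 n) (extChartAt (𝓡 n) x₀).symm
          (extChartAt (𝓡 n) x₀ (g.diffeo τ x))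
          (X.chartForm x₀ (τ, extChartAt (𝓡 n) x₀ (g.diffeo τ x)) u) =
        X.contract τ u (g.diffeo τ x) := fun τ hτ u =>
      (X.mfderiv_symm_chartForm x₀ ((extChartAt (𝓡 n) x₀).map_source (hgood τ hτ).1) u).trans
        (congrArg (fun y => (X.contract τ u y : EuclideanSpace ℝ (Fin n)))
          ((extChartAt (𝓡 n) x₀).left_inv (hgood τ hτ).1))
    have hsol := fderiv_eq_of_radial (isOpen_chartDomain s x₀)
      ((X.contDiffOn_chartForm x₀).of_le (by simp))
      (fun p hp a b => hX.fderiv_chartForm X x₀ hp a b)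
      (γ := fun τ => extChartAt (𝓡 n) x₀ (g.diffeo τ x)) (t₀ := t₀) (δ := δ)
      (fun τ hτ => (((g.mfderiv_symm_fderiv_chart x₀ (hgood τ hτ).1 0).1.of_le
        ENat.LEInfty.out).contDiffWithinAt))
      (fun τ hτ => ⟨mem_univ _, (extChartAt (𝓡 n) x₀).map_source (hgood τ hτ).1⟩)
      (fun τ hτ => by
        apply hinj τ hτ
        refine (g.mfderiv_symm_fderiv_chart x₀ (hgood τ hτ).1 (τ - t₀)).2.trans
          (Eq.trans ?_ (hform τ hτ (τ - t₀)).symm)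
        rw [hg.contract_field X τ x, (hgood τ hτ).2, one_smul]) ht
    have h1 := (g.mfderiv_symm_fderiv_chart x₀ (hgood t ht).1 (dirT π)).2
    rw [hsol] at h1
    have h2 := h1.symm.trans (hform t ht (dirT π))
    rwa [PolyField.contract_dirT, PolyField.contract_dirT] at h2
  filter_upwards [hinvFun.eventually hpush] with p hp π
  have e : g.diffeo p.1 (g.invFun p).2 = p.2 := congrArg Prod.snd (g.toFun_invFun p)
  have h := hp π
  change (g.field.vec π p.1 (g.diffeo p.1 (g.invFun p).2) : EuclideanSpace ℝ (Fin n)) = _ at h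
  exact ((congrArg (fun y => (g.field.vec π p.1 y : EuclideanSpace ℝ (Fin n))) e).symm.trans
    h).trans (congrArg (fun y => (X.vec π p.1 y : EuclideanSpace ℝ (Fin n))) e)

/-- Every germ of an integrable polyvector field is generated by a flow. -/
theorem PolyField.IsIntegrable.exists_flow [T2Space N] [SecondCountableTopology N]
    (hX : X.IsIntegrable) (t₀ : Time s) :
    ∃ g : GenFlow s n N t₀, fieldSetoid s n N t₀ ⟨g.field, g.isIntegrable_field⟩ ⟨X, hX⟩ := by
  have hL : LocallyCompactSpace N := Manifold.locallyCompact_of_finiteDimensional (𝓡 n)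
  obtain ⟨ρ, hρ, hρc⟩ := exists_smooth_exhaustion (𝓡 n) N
  obtain ⟨f, hf, hf1, hb⟩ := X.exists_cutoff t₀ hρ
  obtain ⟨g, hg⟩ := X.exists_isRadial hf (X.exists_isMIntegralCurve_rayField hf hρ hρc hb)
  exact ⟨g, eventually_nhdsSet_foot_iff.mpr (hg.eventually_field_eq hX hf1)⟩

end Surjectivity

end TFlow

end

theorem theorem2p1 (s n : ℕ) (N : Type*) [TopologicalSpace N] [T2Space N]
    [SecondCountableTopology N] [ChartedSpace (EuclideanSpace ℝ (Fin n)) N]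
    [IsManifold (𝓡 n) ∞ N] (t₀ : TFlow.Time s) :
    ∃ Φ : TFlow.FlowGerm s n N t₀ → TFlow.FieldGerm s n N t₀,
      (∀ g : TFlow.GenFlow s n N t₀, ∃ (X : TFlow.PolyField s n N) (hX : X.IsIntegrable),
        g.Generates X ∧ Φ g.germ = TFlow.fieldGerm t₀ X hX) ∧
      Function.Bijective Φ := by
  refine ⟨Quotient.map (fun g => ⟨g.field, g.isIntegrable_field⟩)
    fun _ _ h => TFlow.GenFlow.field_germ_eq h,
    fun g => ⟨g.field, g.isIntegrable_field, g.generates_field, rfl⟩, ?_, ?_⟩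
  · refine fun a b => Quotient.inductionOn₂ a b fun g h hgh => ?_
    exact Quotient.sound (TFlow.GenFlow.flow_germ_eq (Quotient.exact hgh))
  · refine fun b => Quotient.inductionOn b fun X => ?_
    obtain ⟨g, hg⟩ := X.2.exists_flow t₀
    exact ⟨g.germ, Quotient.sound hg⟩
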